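/- A temporal digraph $\mathcal D=(D,\lambda)$ with lifetime $\tau$ consists of a finite simple loopless digraph $D$ with $n$ vertices and $m$ arcs and a time function $\lambda$ assigning to each arc a (possibly empty) subset of $\{1,\dots,\tau\}$. For vertices $x,y$, a (non-trivial, non-strict) temporal $x,y$-path is a sequence $(v_0,t_0,v_1,\dots,t_{q-1},v_q)$ with $q\ge 1$, $v_0=x$, $v_q=y$, such that each $v_iv_{i+1}$ is an arc of $D$ with $t_i\in\lambda(v_iv_{i+1})$, the times satisfy $t_0\le t_1\le\dots\le t_{q-1}$, and no vertex is repeated (apart from $v_0=v_q$ when $x=y$). A cycle $C$ of $D$ is a strong cycle of $\mathcal D$ if for every vertex $x$ of $C$ there is a temporal $x,x$-path whose set of arcs is the set of arcs of $C$. The problem Strong Cycle Detection asks, given $\mathcal D$ (with $\lambda$ listed explicitly on the arcs), whether $\mathcal D$ contains a strong cycle. **Theorem.** Strong Cycle Detection is fixed-parameter tractable with respect to the lifetime $\tau$: on a unit-cost random access machine (with addition and truncated subtraction as its arithmetic), there are a deterministic algorithm deciding it, a computable function $f$ and a constant $d$ such that the running time on every instance is at most $f(\tau)\,(n+m+1)^{d}$.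 More precisely, there is a deterministic algorithm on this machine that decides Strong Cycle Detection in time $$O\!\left(n\,m^2\,\tau^2\,4^{(\tau+1)^2}\right)$$ on all instances with $m\ge 1$ and $\tau\ge 1$, and in time $O(1)$ on the instances with $m=0$ or $\tau=0$. -/

import Mathlib

/-! ## Temporal digraphs and strong cycles -/

/-- A temporal digraph: a simple (loopless) underlying digraph, a lifetime `τ`, and a time function
assigning to each arc `(u, v)` a (possibly empty) subset of `[τ] = {1, …, τ}`.  The values of `time`
at pairs that are not arcs are irrelevant. -/
structure TemporalDigraph (V : Type*) where
  graph : Digraph V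
  loopless : ∀ v, ¬ graph.Adj v v
  lifetime : ℕ
  time : V → V → Finset ℕ
  time_subset : ∀ u v, graph.Adj u v → time u v ⊆ Finset.Icc 1 lifetime

namespace TemporalDigraph

variable {V : Type*}

/-- The sequence `v_0, …, v_q` is a walk of length `q` in the underlying digraph. -/
def IsWalk (D : TemporalDigraph V) {q : ℕ} (v : Fin (q + 1) → V) : Prop :=
  ∀ i : Fin q, D.graph.Adj (v i.castSucc) (v i.succ)

/-- The set of arcs traversed by the sequence `v_0, …, v_q`. -/
def arcSet {q : ℕ} (v : Fin (q + 1) → V) : Set (V × V) :=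
  Set.range fun i : Fin q => (v i.castSucc, v i.succ)

/-- The terms of `v_0, …, v_q` are pairwise distinct, except that `v_0 = v_q` is allowed. -/
def IsSimple {q : ℕ} (v : Fin (q + 1) → V) : Prop :=
  ∀ i j : Fin (q + 1), i < j → v i = v j → i = 0 ∧ j = Fin.last q

/-- A cycle of the underlying digraph, written as a closed walk `v_0, …, v_q = v_0` with `q ≥ 1`
and `v_0, …, v_{q-1}` distinct. -/
def IsCycle (D : TemporalDigraph V) {q : ℕ} (v : Fin (q + 1) → V) : Prop :=
  1 ≤ q ∧ D.IsWalk v ∧ v 0 = v (Fin.last q) ∧ IsSimple v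

/-- `(v_0, t_0, v_1, …, t_{q-1}, v_q)` is a non-trivial temporal `x,y`-path (non-strict model):
consecutive vertices are joined by arcs, arc number `i` is available at time `t_i`, the times are
non-decreasing, and no vertex is repeated (apart from the two ends when `x = y`). -/
def IsTemporalPath (D : TemporalDigraph V) (x y : V) {q : ℕ}
    (v : Fin (q + 1) → V) (t : Fin q → ℕ) : Prop :=
  1 ≤ q ∧ D.IsWalk v ∧ (∀ i : Fin q, t i ∈ D.time (v i.castSucc) (v i.succ)) ∧ Monotone t ∧
    v 0 = x ∧ v (Fin.last q) = y ∧ IsSimple v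

/-- A strong cycle: a cycle `C` such that for every vertex `x` of `C` there is a temporal
`x,x`-path whose set of arcs is the set of arcs of `C`. -/
def IsStrongCycle (D : TemporalDigraph V) {q : ℕ} (c : Fin (q + 1) → V) : Prop :=
  D.IsCycle c ∧ ∀ x ∈ Set.range c, ∃ (p : ℕ) (v : Fin (p + 1) → V) (t : Fin p → ℕ),
    D.IsTemporalPath x x v t ∧ arcSet v = arcSet c

def HasStrongCycle (D : TemporalDigraph V) : Prop :=
  ∃ (q : ℕ) (c : Fin (q + 1) → V), D.IsStrongCycle c

end TemporalDigraph

/-! ## Random access machines with unit cost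

The memory consists of arrays numbered `0, 1, 2, …`, each with cells numbered `0, 1, 2, …` that hold
natural numbers (a program mentions finitely many arrays).  The arithmetic is addition and truncated
subtraction.  Every evaluation of a constant, memory access, arithmetic operation, assignment and
test costs one step. -/

namespace RAM

abbrev Memory := ℕ → ℕ → ℕ

/-- Expressions; `get k e` reads the cell of array `k` whose index is the value of `e`. -/
inductive Expr
  | lit (c : ℕ)
  | get (k : ℕ) (e : Expr)
  | add (e₁ e₂ : Expr)
  | sub (e₁ e₂ : Expr)

def Expr.eval (σ : Memory) : Expr → ℕ
  | .lit c => c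
  | .get k e => σ k (e.eval σ)
  | .add e₁ e₂ => e₁.eval σ + e₂.eval σ
  | .sub e₁ e₂ => e₁.eval σ - e₂.eval σ

def Expr.cost : Expr → ℕ
  | .lit _ => 1
  | .get _ e => e.cost + 1
  | .add e₁ e₂ => e₁.cost + e₂.cost + 1
  | .sub e₁ e₂ => e₁.cost + e₂.cost + 1

/-- Programs; `set k i e` writes the value of `e` to the cell of array `k` whose index is the value
of `i`, and tests ask whether the value of an expression is non-zero. -/
inductive Prog
  | skip
  | set (k : ℕ) (i e : Expr)
  | seq (c₁ c₂ : Prog)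
  | ite (e : Expr) (c₁ c₂ : Prog)
  | loop (e : Expr) (c : Prog)

def Memory.update (σ : Memory) (k i a : ℕ) : Memory :=
  Function.update σ k (Function.update (σ k) i a)

/-- `Exec c σ σ' t`: started in memory `σ`, the program `c` halts in memory `σ'` after exactly `t`
steps. -/
inductive Exec : Prog → Memory → Memory → ℕ → Prop
  | skip (σ : Memory) : Exec .skip σ σ 1
  | set (k : ℕ) (i e : Expr) (σ : Memory) :
      Exec (.set k i e) σ (σ.update k (i.eval σ) (e.eval σ)) (i.cost + e.cost + 1)
  | seq {c₁ c₂ : Prog} {σ σ' σ'' : Memory} {t₁ t₂ : ℕ} :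
      Exec c₁ σ σ' t₁ → Exec c₂ σ' σ'' t₂ → Exec (.seq c₁ c₂) σ σ'' (t₁ + t₂)
  | ite_true {e : Expr} {c₁ c₂ : Prog} {σ σ' : Memory} {t : ℕ} :
      e.eval σ ≠ 0 → Exec c₁ σ σ' t → Exec (.ite e c₁ c₂) σ σ' (e.cost + 1 + t)
  | ite_false {e : Expr} {c₁ c₂ : Prog} {σ σ' : Memory} {t : ℕ} :
      e.eval σ = 0 → Exec c₂ σ σ' t → Exec (.ite e c₁ c₂) σ σ' (e.cost + 1 + t)
  | loop_done {e : Expr} {c : Prog} {σ : Memory} :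
      e.eval σ = 0 → Exec (.loop e c) σ σ (e.cost + 1)
  | loop_step {e : Expr} {c : Prog} {σ σ' σ'' : Memory} {t₁ t₂ : ℕ} :
      e.eval σ ≠ 0 → Exec c σ σ' t₁ → Exec (.loop e c) σ' σ'' t₂ →
      Exec (.loop e c) σ σ'' (e.cost + 1 + t₁ + t₂)

/-- The input word is stored in array `0`; all other cells are zero. -/
def initial (w : List ℕ) : Memory :=
  fun k i => if k = 0 then w.getD i 0 else 0

/-- On input `w` the program halts after exactly `t` steps, and cell `0` of array `1` then holds `1`
if `answer` is true and `0` if it is false. -/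
def Answers (c : Prog) (w : List ℕ) (answer : Prop) (t : ℕ) : Prop :=
  ∃ σ' : Memory, Exec c (initial w) σ' t ∧ (answer → σ' 1 0 = 1) ∧ (¬ answer → σ' 1 0 = 0)

/-- A decision problem on instances of type `I`, given through an encoding by words of natural
numbers, with a size and a parameter, is fixed-parameter tractable: one program decides all
instances `x` within `f (param x) * (size x + 1) ^ d` steps, with `f` computable and `d` fixed. -/
def FixedParameterTractable {I : Type*} (encode : I → List ℕ) (size param : I → ℕ)
    (yes : I → Prop) : Prop :=
  ∃ (c : Prog) (f : ℕ → ℕ) (d : ℕ), Computable f ∧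
    ∀ x : I, ∃ t : ℕ, t ≤ f (param x) * (size x + 1) ^ d ∧ Answers c (encode x) (yes x) t

end RAM

/-! ## Strong Cycle Detection -/

/-- An instance: a temporal digraph on the vertices `0, …, n - 1`, presented with an arbitrary list
of its arcs, in which every arc occurs exactly once. -/
structure CycleInstance where
  n : ℕ
  D : TemporalDigraph (Fin n)
  arcs : List (Fin n × Fin n)
  nodup : arcs.Nodup
  mem_arcs : ∀ a : Fin n × Fin n, a ∈ arcs ↔ D.graph.Adj a.1 a.2

namespace CycleInstance

/-- The number of arcs. -/
def m (x : CycleInstance) : ℕ := x.arcs.length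

/-- The lifetime. -/
def τ (x : CycleInstance) : ℕ := x.D.lifetime

/-- The input word: `n`, `m`, `τ`, and then for each arc its tail, its head and the characteristic
vector of its set of times, as a subset of `{1, …, τ}`. -/
def encode (x : CycleInstance) : List ℕ :=
  x.n :: x.m :: x.τ :: x.arcs.flatMap fun a =>
    (a.1 : ℕ) :: (a.2 : ℕ) ::
      (List.range x.τ).map fun i => if i + 1 ∈ x.D.time a.1 a.2 then 1 else 0

def HasStrongCycle (x : CycleInstance) : Prop := x.D.HasStrongCycle

end CycleInstance

/-!
Strong cycles are reduced to closed walks that are recognized by finitely many tokens, and such a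
walk is found by breadth-first search.

Call a list of arcs strong if each of its rotations can be followed at non-decreasing times. If a
strong closed walk repeats a vertex, then the closed part between the two visits is strong again,
because its rotations are sublists of rotations of the whole (`Strong.infix`). So there is a strong
cycle if and only if there is a non-empty strong closed walk (`TemporalDigraph.hasStrongCycle_iff`).

For a walk `L = P ++ S`, the rotation `S ++ P` can be followed if and only if the traveller who
starts `S` at time `1` and is always as early as possible reaches the end of `S` at a time `c` from
which `P` can still be completed. All these conditions are checked in one pass over `L` with
`τ + 1` tokens. Token `d` represents a traveller ready at time `d` at the beginning of `L`; when this
traveller gets stuck, at the end of some `P`, a second one starts there at time `1`. By monotonicity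
of arrival times, the failing rotations with `c = d` all start at the end of `P` or later, every
rotation starting there with `c ≥ d` fails, and `c` is largest for the one starting at the end of
`P`. So `L` is strong if and only if for every `d` the second traveller, if there is one, arrives
before time `d` (`TemporalDigraph.strong_iff_token`). Encoding the second traveller at time `s` as `τ + s`, the
condition becomes `token L d < τ + d`, and getting stuck, time `τ + 1`, coincides with restarting at
time `1`.

A search state consists of the first and the last vertex of a walk and the `τ + 1` positions of its
tokens, which are numbers below `2 ^ (τ + 1)`. Apart from the `n` initial ones, its last vertex is
the head of an arc, so there are at most `n + n m 2 ^ ((τ + 1) ^ 2)` entries in the queue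
(`RAM.SearchInv.length_le`). Each entry is tested against all `m` arcs, and a new state and its index
in the array of marks are computed in `O((τ + 1) ^ 2)` steps. This stays below the required bound,
where the base of the exponential is `4`.

Programs are verified with total-correctness triples carrying a time bound (`RAM.Runs`); the
invariant of the search is `RAM.SearchInv`.
-/

/-! ### Arrival times and closed walks -/

namespace TemporalDigraph

variable {V : Type*} (D : TemporalDigraph V)

theorem exists_next (a : V × V) (t : ℕ) :
    ∃ s, t ≤ s ∧ (s ∈ D.time a.1 a.2 ∨ D.lifetime < s) :=
  ⟨max t (D.lifetime + 1), le_max_left _ _, Or.inr (by omega)⟩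

/-- The earliest time `s ≥ t` at which the arc `a` is available; any time beyond the lifetime counts
as available, so that `lifetime + 1` plays the role of `∞`. -/
def next (a : V × V) (t : ℕ) : ℕ := Nat.find (D.exists_next a t)

theorem le_next (a : V × V) (t : ℕ) : t ≤ D.next a t := (Nat.find_spec (D.exists_next a t)).1

theorem next_mem (a : V × V) (t : ℕ) :
    D.next a t ∈ D.time a.1 a.2 ∨ D.lifetime < D.next a t :=
  (Nat.find_spec (D.exists_next a t)).2

theorem next_le_of {a : V × V} {t s : ℕ} (h : t ≤ s)
    (h' : s ∈ D.time a.1 a.2 ∨ D.lifetime < s) : D.next a t ≤ s :=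
  Nat.find_min' (D.exists_next a t) ⟨h, h'⟩

theorem next_mono (a : V × V) : Monotone (D.next a) := fun _ t h =>
  D.next_le_of (h.trans (D.le_next a t)) (D.next_mem a t)

theorem next_le {a : V × V} {t : ℕ} (h : t ≤ D.lifetime + 1) : D.next a t ≤ D.lifetime + 1 :=
  D.next_le_of h (Or.inr (by omega))

/-- The time at which the last arc of `L` is traversed when one is ready for its first arc at time
`t` and always takes the next arc as early as possible (`t` itself if `L` is empty); it exceeds the lifetime
if there is no such time. -/
def arrive (L : List (V × V)) (t : ℕ) : ℕ := L.foldl (fun s a => D.next a s) t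

@[simp] theorem arrive_nil (t : ℕ) : D.arrive [] t = t := rfl

@[simp] theorem arrive_cons (a : V × V) (L : List (V × V)) (t : ℕ) :
    D.arrive (a :: L) t = D.arrive L (D.next a t) := rfl

theorem arrive_append (L L' : List (V × V)) (t : ℕ) :
    D.arrive (L ++ L') t = D.arrive L' (D.arrive L t) := List.foldl_append ..

theorem arrive_mono (L : List (V × V)) : Monotone (D.arrive L) := by
  induction L with
  | nil => exact monotone_id
  | cons a L ih => exact ih.comp (D.next_mono a)

theorem le_arrive (L : List (V × V)) (t : ℕ) : t ≤ D.arrive L t := by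
  induction L generalizing t with
  | nil => exact le_rfl
  | cons a L ih => exact (D.le_next a t).trans (ih _)

theorem arrive_le (L : List (V × V)) {t : ℕ} (h : t ≤ D.lifetime + 1) :
    D.arrive L t ≤ D.lifetime + 1 := by
  induction L generalizing t with
  | nil => exact h
  | cons a L ih => exact ih (D.next_le h)

/-- The arcs of `L` are available, in this order, at non-decreasing times that are at least `t`. -/
def Follows : ℕ → List (V × V) → Prop
  | _, [] => True
  | t, a :: L => ∃ s ∈ D.time a.1 a.2, t ≤ s ∧ Follows s L

variable {D}

theorem Follows.anti {t t' : ℕ} (h : t' ≤ t) : ∀ {L : List (V × V)}, D.Follows t L → D.Follows t' L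
  | [], _ => trivial
  | _ :: _, ⟨s, hs, hts, hL⟩ => ⟨s, hs, h.trans hts, hL⟩

theorem Follows.sublist {L L' : List (V × V)} (h : L'.Sublist L) :
    ∀ {t : ℕ}, D.Follows t L → D.Follows t L' := by
  induction h with
  | slnil => exact id
  | cons a _ ih => exact fun ⟨_, _, hts, hL⟩ => ih (hL.anti hts)
  | cons_cons a _ ih => exact fun ⟨s, hs, hts, hL⟩ => ⟨s, hs, hts, ih hL⟩

theorem arrive_le_lifetime_iff {L : List (V × V)} (hL : ∀ a ∈ L, D.graph.Adj a.1 a.2) {t : ℕ}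
    (ht : t ≤ D.lifetime) : D.arrive L t ≤ D.lifetime ↔ D.Follows t L := by
  induction L generalizing t with
  | nil => simp [Follows, ht]
  | cons a L ih =>
    have hL' : ∀ b ∈ L, D.graph.Adj b.1 b.2 := fun b hb => hL b (by simp [hb])
    rw [arrive_cons]
    constructor
    · intro h
      have h1 : D.next a t ≤ D.lifetime := (D.le_arrive L _).trans h
      refine ⟨_, (D.next_mem a t).resolve_right (by omega), D.le_next a t, ?_⟩
      exact (ih hL' h1).1 h
    · rintro ⟨s, hs, hts, hF⟩
      have h1 : s ≤ D.lifetime :=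
        (Finset.mem_Icc.1 (D.time_subset _ _ (hL a (by simp)) hs)).2
      have h2 : D.next a t ≤ s := D.next_le_of hts (Or.inl hs)
      exact (ih hL' (h2.trans h1)).2 (hF.anti h2)

/-- `Follows`, with the times given by a function. -/
theorem follows_iff {L : List (V × V)} {t : ℕ} : D.Follows t L ↔
    ∃ f : ℕ → ℕ, (∀ i (h : i < L.length), f i ∈ D.time L[i].1 L[i].2 ∧ t ≤ f i) ∧
      ∀ i j, i ≤ j → j < L.length → f i ≤ f j := by
  induction L generalizing t with
  | nil => simp [Follows]
  | cons a L ih =>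
    constructor
    · rintro ⟨s, hs, hts, hF⟩
      obtain ⟨f, hf, hmono⟩ := ih.1 hF
      refine ⟨fun i => Nat.casesOn i s f, ?_, ?_⟩
      · rintro (_ | i) h
        · exact ⟨hs, hts⟩
        · have := hf i (by simpa using h)
          exact ⟨this.1, hts.trans this.2⟩
      · rintro (_ | i) (_ | j) hij hj
        · exact le_rfl
        · exact (hf j (by simpa using hj)).2
        · omega
        · exact hmono i j (by omega) (by simpa using hj)
    · rintro ⟨f, hf, hmono⟩
      have h0 := hf 0 (by simp)
      refine ⟨f 0, h0.1, h0.2, ih.2 ⟨fun i => f (i + 1), fun i h => ⟨?_, ?_⟩, ?_⟩⟩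
      · exact (hf (i + 1) (by simpa using h)).1
      · exact hmono 0 (i + 1) (by omega) (by simpa using h)
      · exact fun i j hij hj => hmono _ _ (by omega) (by simpa using hj)

variable (D)

/-- `L` is the list of arcs of a walk from `u` to `v`. -/
def Walk : V → V → List (V × V) → Prop
  | u, v, [] => u = v
  | u, v, a :: L => a.1 = u ∧ D.graph.Adj a.1 a.2 ∧ Walk a.2 v L

/-- Every rotation of the list of arcs `L` can be followed in time: for closed walks this is the
analogue of being a strong cycle. -/
def Strong (L : List (V × V)) : Prop := ∀ P S, L = P ++ S → D.Follows 1 (S ++ P)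

variable {D}

theorem Walk.adj {L : List (V × V)} : ∀ {u v : V}, D.Walk u v L → ∀ a ∈ L, D.graph.Adj a.1 a.2 := by
  induction L with
  | nil => simp
  | cons b L ih =>
    rintro u v ⟨-, h, hL⟩ a ha
    rcases List.mem_cons.1 ha with rfl | ha
    exacts [h, ih hL a ha]

theorem walk_append {L L' : List (V × V)} {u w : V} :
    D.Walk u w (L ++ L') ↔ ∃ v, D.Walk u v L ∧ D.Walk v w L' := by
  induction L generalizing u with
  | nil => simp [Walk]
  | cons a L ih => simp [Walk, ih, and_assoc]

/-- The closed walk obtained by cutting out of a strong walk everything but a closed part is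
strong: a rotation of the part is a sublist of a rotation of the whole. -/
theorem Strong.infix {A M C : List (V × V)} (h : D.Strong (A ++ M ++ C)) : D.Strong M := by
  rintro P S rfl
  refine (h (A ++ P) (S ++ C) (by simp)).sublist ?_
  rw [List.append_assoc, ← List.append_assoc C]
  exact (List.sublist_append_right _ _).append_left _

/-- A shortest strong closed walk repeats no vertex. -/
theorem exists_nodup_strong {v : V} {L : List (V × V)} (h0 : L ≠ []) (hw : D.Walk v v L)
    (hs : D.Strong L) :
    ∃ v L, L ≠ [] ∧ D.Walk v v L ∧ D.Strong L ∧ (L.map Prod.fst).Nodup := by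
  induction hn : L.length using Nat.strong_induction_on generalizing v L with
  | _ n ih =>
    by_cases hd : (L.map Prod.fst).Nodup
    · exact ⟨v, L, h0, hw, hs, hd⟩
    · have : ∃ A a M b C, L = A ++ (a :: M) ++ (b :: C) ∧ a.1 = b.1 := by
        clear ih hn hs hw h0
        induction L with
        | nil => simp at hd
        | cons a L ih =>
          by_cases ha : a.1 ∈ L.map Prod.fst
          · obtain ⟨b, hb, hab⟩ := List.mem_map.1 ha
            obtain ⟨M, C, rfl⟩ := List.append_of_mem hb
            exact ⟨[], a, M, b, C, by simp, hab.symm⟩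
          · obtain ⟨A, a', M, b, C, rfl, h⟩ := ih (by
              rw [List.map_cons, List.nodup_cons] at hd
              tauto)
            exact ⟨a :: A, a', M, b, C, by simp, h⟩
      obtain ⟨A, a, M, b, C, rfl, hab⟩ := this
      obtain ⟨w, hw1, hw2⟩ := walk_append.1 hw
      obtain ⟨u, -, hu⟩ := walk_append.1 hw1
      have hwb : w = a.1 := hab ▸ hw2.1.symm
      have hua : u = a.1 := hu.1.symm
      subst hua
      rw [hwb] at hu
      exact ih _ (by simp at hn ⊢; omega) (by simp) hu hs.infix rfl

/-- The vertices of the walk to `v` with the list of arcs `L`: the tails of the arcs, and then `v`. -/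
def vertices (v : V) (L : List (V × V)) (i : Fin (L.length + 1)) : V :=
  if h : i.1 < L.length then L[i.1].1 else v

theorem Walk.snd_getElem {L : List (V × V)} : ∀ {u v : V}, D.Walk u v L →
    ∀ i (h : i < L.length), L[i].2 = if h : i + 1 < L.length then L[i + 1].1 else v := by
  induction L with
  | nil => simp
  | cons a L ih =>
    rintro u v ⟨-, -, hL⟩ i h
    cases i with
    | zero =>
      cases L with
      | nil => simpa [Walk] using hL
      | cons b L => simp [hL.1]
    | succ i =>
      have := ih hL i (by simpa using h)
      simpa using this

theorem Walk.vertices_arc {u v : V} {L : List (V × V)} (h : D.Walk u v L) (i : Fin L.length) :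
    (vertices v L i.castSucc, vertices v L i.succ) = L[i.1] := by
  have := h.snd_getElem i.1 i.2
  ext <;> simp [vertices, this]

theorem Walk.vertices_zero {v : V} {L : List (V × V)} (h : D.Walk v v L) : vertices v L 0 = v := by
  cases L with
  | nil => simp [vertices]
  | cons a L => simpa [vertices] using h.1

theorem vertices_last (v : V) (L : List (V × V)) : vertices v L (Fin.last _) = v := by
  simp [vertices]

theorem Walk.isWalk {u v : V} {L : List (V × V)} (h : D.Walk u v L) :
    D.IsWalk (vertices v L) := fun i => by
  have h1 := h.vertices_arc i
  have h2 := h.adj L[i.1] (List.getElem_mem _)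
  rwa [← h1] at h2

theorem Walk.arcSet_vertices {u v : V} {L : List (V × V)} (h : D.Walk u v L) :
    arcSet (vertices v L) = {a | a ∈ L} := by
  ext a
  simp only [arcSet, Set.mem_range, Set.mem_ofPred_eq, h.vertices_arc, List.mem_iff_getElem]
  exact ⟨fun ⟨i, hi⟩ => ⟨i, i.2, hi⟩, fun ⟨i, h, hi⟩ => ⟨⟨i, h⟩, hi⟩⟩

theorem isSimple_vertices {v : V} {L : List (V × V)} (hw : D.Walk v v L)
    (h : (L.map Prod.fst).Nodup) : IsSimple (vertices v L) := by
  intro i j hij he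
  have hi : i.1 < L.length := by have := j.2; omega
  have key : ∀ k (hk : k < L.length), L[i.1].1 = L[k].1 → i.1 = k := fun k hk hk' =>
    (h.getElem_inj_iff (hi := by simpa using hi) (hj := by simpa using hk)).1 (by simpa using hk')
  by_cases hj : j.1 < L.length
  · simp only [vertices, hi, hj, dif_pos] at he
    have := key _ hj he
    omega
  · have h0' : 0 < L.length := by omega
    have h0 : L[0].1 = v := by simpa [vertices, h0'] using hw.vertices_zero
    simp only [vertices, hi, hj, dif_pos, dif_neg, not_false_iff] at he
    have := key 0 h0' (he.trans h0.symm)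
    exact ⟨Fin.ext this, Fin.ext (by simp; omega)⟩

theorem walk_ofFn {q : ℕ} (c : Fin (q + 1) → V) (h : D.IsWalk c) :
    D.Walk (c 0) (c (Fin.last q)) (List.ofFn fun i : Fin q => (c i.castSucc, c i.succ)) := by
  induction q with
  | zero => simp [Walk]
  | succ q ih =>
    rw [List.ofFn_succ]
    refine ⟨rfl, h 0, ?_⟩
    exact ih (fun i => c i.succ) fun i => h i.succ

/-- It suffices to look for strong closed walks: a shortest one is a cycle, and conversely a temporal
path with the arcs of a cycle runs along a rotation of this cycle. -/
theorem hasStrongCycle_iff :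
    D.HasStrongCycle ↔ ∃ v L, L ≠ [] ∧ D.Walk v v L ∧ D.Strong L := by
  constructor
  · rintro ⟨q, c, ⟨hq, hcw, hc0, hcs⟩, hst⟩
    set L := List.ofFn fun i : Fin q => (c i.castSucc, c i.succ) with hLdef
    have hlen : L.length = q := by simp [hLdef]
    refine ⟨c 0, L, by rw [← List.length_pos_iff]; omega, ?_, ?_⟩
    · have := walk_ofFn c hcw
      rwa [← hc0] at this
    -- The rotation of the cycle that starts at its `k`-th vertex can be followed in time.
    have rot : ∀ k, k < q → D.Follows 1 (L.rotate k) := by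
      intro k hk
      obtain ⟨p, v, t, ⟨hp, hvw, ht, htm, hv0, hvl, hvs⟩, harc⟩ :=
        hst (c ⟨k, by omega⟩) ⟨_, rfl⟩
      have inj : ∀ i j (hi : i < q) (hj : j < q),
          c ⟨i, by omega⟩ = c ⟨j, by omega⟩ → i = j := by
        intro i j hi hj he
        rcases lt_trichotomy i j with h | h | h
        · have := (hcs ⟨i, by omega⟩ ⟨j, by omega⟩ h he).2
          simp [Fin.ext_iff] at this; omega
        · exact h
        · have := (hcs ⟨j, by omega⟩ ⟨i, by omega⟩ h he.symm).2
          simp [Fin.ext_iff] at this; omega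
      -- A vertex of a cycle has one successor, so the path runs along the cycle.
      have step : ∀ i (hi : i < p) l (hl : l < q), v ⟨i, by omega⟩ = c ⟨l, by omega⟩ →
          v ⟨i + 1, by omega⟩ = c ⟨l + 1, by omega⟩ := by
        intro i hi l hl he
        have : (v (Fin.castSucc ⟨i, hi⟩), v (Fin.succ ⟨i, hi⟩)) ∈ arcSet c :=
          harc ▸ ⟨⟨i, hi⟩, rfl⟩
        obtain ⟨j, hj⟩ := this
        simp only [Prod.mk.injEq] at hj
        have hjl : j.1 = l := inj _ _ j.2 hl (hj.1.trans he)
        have := hj.2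
        rw [show j = ⟨l, hl⟩ from Fin.ext hjl] at this
        exact this.symm
      have wrap : ∀ l (hl : l < q), c ⟨l + 1, by omega⟩ = c ⟨(l + 1) % q, by
          have := Nat.mod_lt (l + 1) hq; omega⟩ := by
        intro l hl
        rcases Nat.lt_or_ge (l + 1) q with h | h
        · simp only [Nat.mod_eq_of_lt h]
        · have h' : l + 1 = q := by omega
          simp only [h', Nat.mod_self]
          exact hc0.symm
      have pos : ∀ i (hi : i < p + 1), v ⟨i, hi⟩ = c ⟨(i + k) % q, by
          have := Nat.mod_lt (i + k) hq; omega⟩ := by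
        intro i
        induction i with
        | zero =>
          intro _
          simp only [Nat.zero_add, Nat.mod_eq_of_lt hk]
          exact hv0
        | succ i ih =>
          intro hi
          have hm := Nat.mod_lt (i + k) hq
          rw [step i (by omega) _ hm (ih (by omega)), wrap _ hm]
          congr 2
          rw [Nat.mod_add_mod]; congr 1; omega
      have hpq : q ≤ p := by
        have h1 := pos p (by omega)
        have h2 : v ⟨p, by omega⟩ = c ⟨k, by omega⟩ := hvl
        have h3 := inj _ _ (Nat.mod_lt _ hq) hk (h1.symm.trans h2)
        refine Nat.le_of_dvd hp ((Nat.modEq_zero_iff_dvd).1 ?_)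
        have : p + k ≡ 0 + k [MOD q] := by
          simp only [Nat.ModEq, h3, Nat.zero_add, Nat.mod_eq_of_lt hk]
        exact Nat.ModEq.add_right_cancel' k this
      refine follows_iff.2 ⟨fun i => if h : i < p then t ⟨i, h⟩ else 0, ?_, ?_⟩
      · intro i hi
        rw [List.length_rotate, hlen] at hi
        have hip : i < p := by omega
        have hmem := ht ⟨i, hip⟩
        have hadj := hvw ⟨i, hip⟩
        have hm := Nat.mod_lt (i + k) hq
        have e1 : v (Fin.castSucc ⟨i, hip⟩) = (L.rotate k)[i].1 := by
          simp only [List.getElem_rotate, hLdef, List.getElem_ofFn, List.length_ofFn]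
          exact pos i (by omega)
        have e2 : v (Fin.succ ⟨i, hip⟩) = (L.rotate k)[i].2 := by
          simp only [List.getElem_rotate, hLdef, List.getElem_ofFn, List.length_ofFn]
          exact step i hip _ hm (pos i (by omega))
        have h1 := (Finset.mem_Icc.1 (D.time_subset _ _ hadj hmem)).1
        rw [e1, e2] at hmem
        simp only [dif_pos hip]
        exact ⟨hmem, h1⟩
      · intro i j hij hj
        rw [List.length_rotate, hlen] at hj
        simp only [show i < p by omega, show j < p by omega, dif_pos]
        exact htm (show (⟨i, _⟩ : Fin p) ≤ ⟨j, _⟩ from hij)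
    intro P S hPS
    have hr : L.rotate P.length = S ++ P := by rw [hPS, List.rotate_append_length_eq]
    rcases Nat.lt_or_ge P.length q with h | h
    · exact hr ▸ rot _ h
    · have h1 : L.length = P.length + S.length := by rw [hPS]; simp
      have h2 : S = [] := List.length_eq_zero_iff.1 (by omega)
      have := rot 0 hq
      rw [List.rotate_zero, hPS] at this
      simpa [h2] using this
  · rintro ⟨v, L, h0, hw, hs⟩
    obtain ⟨v, L, h0, hw, hs, hd⟩ := exists_nodup_strong h0 hw hs
    refine ⟨L.length, vertices v L, ⟨List.length_pos_iff.2 h0, hw.isWalk, ?_,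
      isSimple_vertices hw hd⟩, ?_⟩
    · rw [hw.vertices_zero, vertices_last]
    · rintro x ⟨k, rfl⟩
      set x := vertices v L k with hx
      have hsplit : L = L.take k ++ L.drop k := (List.take_append_drop _ _).symm
      have hF := hs _ _ hsplit
      have hw' : D.Walk x x (L.drop k ++ L.take k) := by
        rw [hsplit] at hw
        obtain ⟨u, h1, h2⟩ := walk_append.1 hw
        have hu : u = x := by
          rw [hx, vertices]
          split_ifs with hk
          · rw [List.drop_eq_getElem_cons hk] at h2
            exact h2.1.symm
          · rw [List.drop_eq_nil_of_le (by omega)] at h2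
            exact h2
        subst hu
        exact walk_append.2 ⟨v, h2, h1⟩
      have hperm : (L.drop k ++ L.take k).Perm L := by
        conv_rhs => rw [hsplit]
        exact List.perm_append_comm
      obtain ⟨f, hf, hmono⟩ := follows_iff.1 hF
      refine ⟨_, vertices x (L.drop k ++ L.take k), fun i => f i,
        ⟨?_, hw'.isWalk, ?_, ?_, hw'.vertices_zero, vertices_last _ _, ?_⟩, ?_⟩
      · rw [hperm.length_eq]; exact List.length_pos_iff.2 h0
      · intro i
        have h1 := hw'.vertices_arc i
        have h2 := (hf i.1 i.2).1
        rwa [← h1] at h2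
      · exact fun i j hij => hmono i j hij j.2
      · exact isSimple_vertices hw' ((hperm.map _).nodup_iff.2 hd)
      · rw [hw'.arcSet_vertices, hw.arcSet_vertices]
        ext a
        exact hperm.mem_iff

/-! ### Tokens -/

variable (D)

/-- One step of a token along the arc `a`.  A token `d ≤ lifetime` is a traveller who is ready at
time `d`; a token `lifetime + s` is a traveller who is ready at time `s` after one restart.  A first
traveller who cannot traverse `a` any more becomes `lifetime + 1`, which is the same as restarting
at time `1` after `a`. -/
def advance (a : V × V) (d : ℕ) : ℕ :=
  if d ≤ D.lifetime then D.next a d else D.lifetime + D.next a (d - D.lifetime)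

/-- The position of a token after the arcs of `L`. -/
def token (L : List (V × V)) (d : ℕ) : ℕ := L.foldl (fun d a => D.advance a d) d

@[simp] theorem token_nil (d : ℕ) : D.token [] d = d := rfl

@[simp] theorem token_cons (a : V × V) (L : List (V × V)) (d : ℕ) :
    D.token (a :: L) d = D.token L (D.advance a d) := rfl

theorem token_append (L L' : List (V × V)) (d : ℕ) :
    D.token (L ++ L') d = D.token L' (D.token L d) := List.foldl_append ..

theorem advance_bounds (a : V × V) {d : ℕ} (h1 : 1 ≤ d) (h2 : d ≤ 2 * D.lifetime + 1) :
    1 ≤ D.advance a d ∧ D.advance a d ≤ 2 * D.lifetime + 1 := by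
  unfold advance
  split_ifs with h
  · have h3 := D.le_next a d
    have h4 := D.next_le (a := a) (t := d) (by omega)
    omega
  · have h3 := D.le_next a (d - D.lifetime)
    have h4 := D.next_le (a := a) (t := d - D.lifetime) (by omega)
    omega

theorem token_bounds (L : List (V × V)) {d : ℕ} (h1 : 1 ≤ d) (h2 : d ≤ 2 * D.lifetime + 1) :
    1 ≤ D.token L d ∧ D.token L d ≤ 2 * D.lifetime + 1 := by
  induction L generalizing d with
  | nil => exact ⟨h1, h2⟩
  | cons a L ih => exact ih (D.advance_bounds a h1 h2).1 (D.advance_bounds a h1 h2).2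

theorem token_restarted (L : List (V × V)) {s : ℕ} (hs : 1 ≤ s) :
    D.token L (D.lifetime + s) = D.lifetime + D.arrive L s := by
  induction L generalizing s with
  | nil => rfl
  | cons a L ih =>
    rw [token_cons, advance, if_neg (by omega), Nat.add_sub_cancel_left, arrive_cons,
      ih (hs.trans (D.le_next a s))]

/-- A token that has been restarted splits the walk into the part that the first traveller failed to
complete and the part of the second one. -/
theorem exists_restart (L : List (V × V)) {d : ℕ} (hd : d ≤ D.lifetime + 1)
    (h : D.lifetime < D.token L d) :
    ∃ P S, L = P ++ S ∧ D.lifetime < D.arrive P d ∧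
      D.token L d = D.lifetime + D.arrive S 1 := by
  induction L generalizing d with
  | nil => exact ⟨[], [], rfl, h, le_antisymm hd (by simpa using h)⟩
  | cons a L ih =>
    rcases Nat.lt_or_ge D.lifetime d with h' | h'
    · obtain rfl : d = D.lifetime + 1 := by omega
      exact ⟨[], a :: L, rfl, h', D.token_restarted _ le_rfl⟩
    · rw [token_cons, advance, if_pos h'] at h ⊢
      obtain ⟨P, S, rfl, h1, h2⟩ := ih (D.next_le hd) h
      exact ⟨a :: P, S, rfl, h1, h2⟩

theorem lt_token_of_lt_arrive (L : List (V × V)) {d : ℕ} (h : D.lifetime < D.arrive L d) :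
    D.lifetime < D.token L d := by
  induction L generalizing d with
  | nil => exact h
  | cons a L ih =>
    rw [token_cons, advance]
    split_ifs with h'
    · exact ih h
    · have h1 := D.le_next a (d - D.lifetime)
      rw [token_restarted _ _ (by omega)]
      have h2 := D.le_arrive L (D.next a (d - D.lifetime))
      omega

variable {D}

/-- Strength of a walk is visible in the final positions of `lifetime + 1` tokens.  For a rotation
`S ++ P` of the walk `P ++ S`, the time `arrive S 1` at which the traveller reaches the end of `S`
plays the role of the initial position of the token that detects a failure of this rotation. -/
theorem strong_iff_token (hτ : 1 ≤ D.lifetime) {L : List (V × V)}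
    (hL : ∀ a ∈ L, D.graph.Adj a.1 a.2) :
    D.Strong L ↔ ∀ d, 1 ≤ d → d ≤ D.lifetime + 1 → D.token L d < D.lifetime + d := by
  have key : ∀ P S, L = P ++ S → (D.Follows 1 (S ++ P) ↔ D.arrive P (D.arrive S 1) ≤ D.lifetime) := by
    rintro P S rfl
    rw [← arrive_append, arrive_le_lifetime_iff (fun a ha => hL a ?_) hτ]
    rw [List.mem_append] at ha ⊢; exact ha.symm
  constructor
  · intro h d h1 hd
    by_contra! hcon
    obtain ⟨P, S, hPS, hP, htok⟩ := D.exists_restart L hd (by omega)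
    have h2 := (key P S hPS).1 (h P S hPS)
    have h3 := D.arrive_mono P (show d ≤ D.arrive S 1 by omega)
    omega
  · intro h P S hPS
    rw [key P S hPS]
    by_contra! hcon
    have hc : 1 ≤ D.arrive S 1 := D.le_arrive S 1
    have h1 := h _ hc (D.arrive_le S (by omega))
    have h2 := D.lt_token_of_lt_arrive P hcon
    obtain ⟨s, hs⟩ := Nat.exists_eq_add_of_le h2.le
    have h3 := D.arrive_mono S (show 1 ≤ s by omega)
    rw [hPS, token_append, hs, token_restarted _ _ (by omega)] at h1
    omega

theorem not_hasStrongCycle_of_lifetime_eq_zero (h : D.lifetime = 0) : ¬ D.HasStrongCycle := by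
  rw [hasStrongCycle_iff]
  rintro ⟨v, L, h0, hw, hs⟩
  cases L with
  | nil => exact h0 rfl
  | cons a L =>
    obtain ⟨s, hmem, -⟩ := hs [] (a :: L) rfl
    have := D.time_subset _ _ hw.2.1 hmem
    rw [h] at this
    simp at this

end TemporalDigraph

/-! ### Reasoning about programs -/

namespace RAM

/-- Started in `σ`, the program `c` halts within `T` steps in a memory satisfying `Q`. -/
def Runs (c : Prog) (σ : Memory) (T : ℕ) (Q : Memory → Prop) : Prop :=
  ∃ σ' t, Exec c σ σ' t ∧ t ≤ T ∧ Q σ'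

/-- The scalar variable `k` is cell `0` of array `k`. -/
abbrev Expr.var (k : ℕ) : Expr := .get k (.lit 0)

/-- Assignment to a scalar variable. -/
abbrev Prog.assign (k : ℕ) (e : Expr) : Prog := .set k (.lit 0) e

theorem update_same (σ : Memory) (k i a j : ℕ) :
    (σ.update k i a) k j = if j = i then a else σ k j := by
  simp [Memory.update, Function.update_apply]

theorem update_of_ne {k l : ℕ} (h : l ≠ k) (σ : Memory) (i a : ℕ) :
    (σ.update k i a) l = σ l := by
  simp [Memory.update, Function.update_of_ne h]

theorem update_idem (σ : Memory) (k i a b : ℕ) :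
    (σ.update k i a).update k i b = σ.update k i b := by
  simp [Memory.update]

theorem update_comm {k l : ℕ} (h : k ≠ l) (σ : Memory) (i a j b : ℕ) :
    (σ.update k i a).update l j b = (σ.update l j b).update k i a := by
  simp only [Memory.update, Function.update_of_ne h.symm, Function.update_of_ne h]
  exact Function.update_comm h _ _ _

theorem update_eq_self (σ : Memory) (k i : ℕ) : σ.update k i (σ k i) = σ := by
  simp [Memory.update]

namespace Runs

variable {c c₁ c₂ : Prog} {σ : Memory} {e : Expr} {T T₁ T₂ : ℕ} {Q R : Memory → Prop}

theorem mono (h : Runs c σ T₁ R) (hT : T₁ ≤ T) (hQ : ∀ σ', R σ' → Q σ') : Runs c σ T Q := by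
  obtain ⟨σ', t, h, ht, hR⟩ := h
  exact ⟨σ', t, h, ht.trans hT, hQ _ hR⟩

theorem skip (hT : 1 ≤ T) (hQ : Q σ) : Runs .skip σ T Q := ⟨σ, 1, .skip σ, hT, hQ⟩

theorem set {k : ℕ} {i e : Expr} (hT : i.cost + e.cost + 1 ≤ T)
    (hQ : Q (σ.update k (i.eval σ) (e.eval σ))) : Runs (.set k i e) σ T Q :=
  ⟨_, _, .set k i e σ, hT, hQ⟩

theorem seq (h₁ : Runs c₁ σ T₁ R) (h₂ : ∀ σ', R σ' → Runs c₂ σ' T₂ Q) (hT : T₁ + T₂ ≤ T) :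
    Runs (.seq c₁ c₂) σ T Q := by
  obtain ⟨σ', t, h, ht, hR⟩ := h₁
  obtain ⟨σ'', t', h', ht', hQ⟩ := h₂ σ' hR
  exact ⟨σ'', _, .seq h h', by omega, hQ⟩

theorem set_seq {k : ℕ} {i e : Expr} (hT : i.cost + e.cost + 1 + T₂ ≤ T)
    (h : Runs c (σ.update k (i.eval σ) (e.eval σ)) T₂ Q) : Runs (.seq (.set k i e) c) σ T Q :=
  seq (R := fun σ' => σ' = σ.update k (i.eval σ) (e.eval σ)) (set le_rfl rfl)
    (fun _ h' => h' ▸ h) hT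

theorem ite (h₁ : e.eval σ ≠ 0 → Runs c₁ σ T₁ Q) (h₂ : e.eval σ = 0 → Runs c₂ σ T₁ Q)
    (hT : e.cost + 1 + T₁ ≤ T) : Runs (.ite e c₁ c₂) σ T Q := by
  by_cases h : e.eval σ = 0
  · obtain ⟨σ', t, h', ht, hQ⟩ := h₂ h
    exact ⟨σ', _, .ite_false h h', by omega, hQ⟩
  · obtain ⟨σ', t, h', ht, hQ⟩ := h₁ h
    exact ⟨σ', _, .ite_true h h', by omega, hQ⟩

/-- A loop with invariant `I` and variant `μ`. -/
theorem loop (I : Memory → Prop) (μ : Memory → ℕ) (M : ℕ)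
    (hbody : ∀ σ, I σ → e.eval σ ≠ 0 → Runs c σ T₁ fun σ' => I σ' ∧ μ σ' < μ σ)
    (hI : I σ) (hM : μ σ ≤ M) (hT : M * (T₁ + e.cost + 1) + e.cost + 1 ≤ T)
    (hQ : ∀ σ', I σ' → e.eval σ' = 0 → Q σ') : Runs (.loop e c) σ T Q := by
  induction M generalizing σ T with
  | zero =>
    by_cases h : e.eval σ = 0
    · exact ⟨σ, _, .loop_done h, by omega, hQ _ hI h⟩
    · obtain ⟨_, _, _, _, _, h'⟩ := hbody σ hI h
      omega
  | succ M ih =>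
    by_cases h : e.eval σ = 0
    · refine ⟨σ, _, .loop_done h, ?_, hQ _ hI h⟩
      rw [Nat.succ_mul] at hT; omega
    · obtain ⟨σ', t, h₁, ht, hI', hlt⟩ := hbody σ hI h
      obtain ⟨σ'', t', h₂, ht', hQ'⟩ := ih hI' (by omega) le_rfl
      refine ⟨σ'', _, .loop_step h h₁ h₂, ?_, hQ'⟩
      rw [Nat.succ_mul] at hT; omega

end Runs

end RAM

/-! ### The program -/

namespace RAM

-- Array `0` holds the input and array `1` the answer.  The queue of the breadth-first search takes
-- four arrays: start vertices, current vertices, tokens (`τ + 1` cells for each entry), and start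
-- vertices multiplied by `n`.  The array of marks is indexed by codes of entries.
notation "arrStart" => (2 : ℕ)
notation "arrCur" => (3 : ℕ)
notation "arrTok" => (4 : ℕ)
notation "arrMark" => (5 : ℕ)
notation "arrBase" => (6 : ℕ)
-- Scalars: the entry being processed and the number of entries, with the offsets of their tokens;
-- the position in the input and the index of the arc being processed; the index of a token, its
-- time and the shift by which it has been reduced; the code under construction, the counter of its
-- doublings, the test for acceptance; and the multiple of `n` needed in the initialization.
notation "vHead" => (7 : ℕ)
notation "vLen" => (8 : ℕ)
notation "vHeadPos" => (9 : ℕ)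
notation "vLenPos" => (10 : ℕ)
notation "vArcPos" => (11 : ℕ)
notation "vArc" => (12 : ℕ)
notation "vJ" => (13 : ℕ)
notation "vTime" => (14 : ℕ)
notation "vShift" => (15 : ℕ)
notation "vCode" => (16 : ℕ)
notation "vK" => (17 : ℕ)
notation "vOk" => (18 : ℕ)
notation "vMul" => (19 : ℕ)

open RAM.Expr RAM.Prog

/-- The first three cells of the input hold `n`, `m` and `τ`. -/
abbrev nExpr : Expr := .get 0 (.lit 0)
abbrev mExpr : Expr := .get 0 (.lit 1)
abbrev tauExpr : Expr := .get 0 (.lit 2)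

/-- Increase the time until the current arc is available or the lifetime is exceeded.  The test is
`(1 - bit) - (1 - (τ + 1 - time))`, which is non-zero if and only if the bit is `0` and
`time ≤ τ`. -/
def seekTime : Prog :=
  .loop (.sub (.sub (.lit 1) (.get 0 (.add (.add (.var vArcPos) (.lit 1)) (.var vTime))))
      (.sub (.lit 1) (.sub (.add tauExpr (.lit 1)) (.var vTime))))
    (.assign vTime (.add (.var vTime) (.lit 1)))

/-- Multiply the code by `2 ^ (τ + 1)`. -/
def shiftCode : Prog :=
  .seq (.assign vK (.lit 0)) <|
  .loop (.sub (.add tauExpr (.lit 1)) (.var vK)) <|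
    .seq (.assign vCode (.add (.var vCode) (.var vCode))) <|
    .assign vK (.add (.var vK) (.lit 1))

/-- Advance one token along the current arc, append it to the code, and compare it with its final
bound. -/
def advanceToken : Prog :=
  .seq (.assign vTime (.get arrTok (.add (.var vHeadPos) (.var vJ)))) <|
  .seq (.assign vShift (.lit 0)) <|
  .seq (.ite (.sub (.var vTime) tauExpr)
    (.seq (.assign vShift tauExpr) (.assign vTime (.sub (.var vTime) tauExpr))) .skip) <|
  .seq seekTime <|
  .seq (.set arrTok (.add (.var vLenPos) (.var vJ)) (.add (.var vTime) (.var vShift))) <|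
  .seq shiftCode <|
  .seq (.assign vCode (.add (.var vCode) (.get arrTok (.add (.var vLenPos) (.var vJ))))) <|
  .seq (.ite (.sub (.add (.get arrTok (.add (.var vLenPos) (.var vJ))) (.lit 1))
      (.add tauExpr (.add (.var vJ) (.lit 1))))
    (.assign vOk (.lit 0)) .skip) <|
  .assign vJ (.add (.var vJ) (.lit 1))

/-- Advance all tokens of the current entry along the current arc. -/
def advanceTokens : Prog :=
  .seq (.assign vJ (.lit 0)) <|
  .loop (.sub (.add tauExpr (.lit 1)) (.var vJ)) advanceToken

/-- Write the successor of the current entry along the current arc behind the end of the queue. -/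
def generate : Prog :=
  .seq (.set arrStart (.var vLen) (.get arrStart (.var vHead))) <|
  .seq (.set arrCur (.var vLen) (.get 0 (.add (.var vArcPos) (.lit 1)))) <|
  .seq (.set arrBase (.var vLen) (.get arrBase (.var vHead))) <|
  .seq (.assign vCode (.add (.get arrBase (.var vLen)) (.get arrCur (.var vLen)))) <|
  .seq (.assign vOk (.sub (.lit 1)
    (.add (.sub (.get arrStart (.var vLen)) (.get arrCur (.var vLen)))
      (.sub (.get arrCur (.var vLen)) (.get arrStart (.var vLen)))))) <|
  advanceTokens

/-- Record acceptance, and make the entry behind the end of the queue a part of the queue unless its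
code is marked. -/
def register : Prog :=
  .seq (.ite (.var vOk) (.assign 1 (.lit 1)) .skip) <|
  .ite (.get arrMark (.var vCode)) .skip <|
    .seq (.set arrMark (.var vCode) (.lit 1)) <|
    .seq (.assign vLen (.add (.var vLen) (.lit 1))) <|
    .assign vLenPos (.add (.var vLenPos) (.add tauExpr (.lit 1)))

/-- Generate and register the successor along the current arc if this arc leaves the last vertex of
the current entry, and pass to the next arc. -/
def processArc : Prog :=
  .seq (.ite (.add (.sub (.get 0 (.var vArcPos)) (.get arrCur (.var vHead)))
      (.sub (.get arrCur (.var vHead)) (.get 0 (.var vArcPos))))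
    .skip (.seq generate register)) <|
  .seq (.assign vArcPos (.add (.var vArcPos) (.add tauExpr (.lit 2)))) <|
  .assign vArc (.add (.var vArc) (.lit 1))

/-- Try all arcs on the current entry, and pass to the next entry. -/
def processEntry : Prog :=
  .seq (.assign vArcPos (.lit 3)) <|
  .seq (.assign vArc (.lit 0)) <|
  .seq (.loop (.sub mExpr (.var vArc)) processArc) <|
  .seq (.assign vHeadPos (.add (.var vHeadPos) (.add tauExpr (.lit 1)))) <|
  .assign vHead (.add (.var vHead) (.lit 1))

/-- Write the tokens `1, …, τ + 1` behind the end of the queue. -/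
def initTokens : Prog :=
  .seq (.assign vJ (.lit 0)) <|
  .loop (.sub (.add tauExpr (.lit 1)) (.var vJ)) <|
    .seq (.set arrTok (.add (.var vLenPos) (.var vJ)) (.add (.var vJ) (.lit 1))) <|
    .assign vJ (.add (.var vJ) (.lit 1))

/-- Put the entry of the empty walk at the next vertex into the queue. -/
def initEntry : Prog :=
  .seq (.set arrStart (.var vLen) (.var vLen)) <|
  .seq (.set arrCur (.var vLen) (.var vLen)) <|
  .seq (.set arrBase (.var vLen) (.var vMul)) <|
  .seq (.assign vMul (.add (.var vMul) nExpr)) <|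
  .seq initTokens <|
  .seq (.assign vLenPos (.add (.var vLenPos) (.add tauExpr (.lit 1)))) <|
  .assign vLen (.add (.var vLen) (.lit 1))

/-- The decision procedure: a breadth-first search, skipped if there are no arcs or no times. -/
def strongCycleProg : Prog :=
  .ite mExpr
    (.ite tauExpr
      (.seq (.loop (.sub nExpr (.var vLen)) initEntry)
        (.loop (.sub (.var vLen) (.var vHead)) processEntry))
      .skip)
    .skip

/-! ### Specifications of the inner loops -/

/-- In the input `ρ` of a machine, position `p` is the beginning of the description of the arc `a` of
the instance `x`. -/
structure ArcAt (x : CycleInstance) (ρ : ℕ → ℕ) (a : Fin x.n × Fin x.n) (p : ℕ) : Prop where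
  tail : ρ p = a.1
  head : ρ (p + 1) = a.2
  bit : ∀ t, 1 ≤ t → t ≤ x.τ → ρ (p + 1 + t) = if t ∈ x.D.time a.1 a.2 then 1 else 0

variable {x : CycleInstance} {a : Fin x.n × Fin x.n} {σ : Memory}

theorem runs_seekTime (hτ : σ 0 2 = x.τ) (ha : ArcAt x (σ 0) a (σ vArcPos 0))
    (h1 : 1 ≤ σ vTime 0) (h2 : σ vTime 0 ≤ x.τ + 1) :
    Runs seekTime σ (27 * (x.τ + 1)) fun σ' => σ' = σ.update vTime 0 (x.D.next a (σ vTime 0)) := by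
  set t₀ := σ vTime 0 with ht₀
  refine Runs.loop (fun σ' => ∃ t, t₀ ≤ t ∧ t ≤ x.D.next a t₀ ∧ σ' = σ.update vTime 0 t)
    (fun σ' => x.τ + 1 - σ' vTime 0) x.τ (T₁ := 6) ?_ ?_ ?_ ?_ ?_
  · rintro _ ⟨t, ht, htn, rfl⟩ hc
    have hc' : t ≤ x.τ ∧ t ∉ x.D.time a.1 a.2 := by
      simp [eval, update_same, update_of_ne, hτ] at hc
      have htτ : t ≤ x.τ := by omega
      have hb := ha.bit t (by omega) htτ
      rw [hb] at hc
      refine ⟨htτ, fun hmem => ?_⟩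
      rw [if_pos hmem] at hc
      omega
    refine Runs.set (by simp [cost]) ⟨⟨t + 1, by omega, ?_, ?_⟩, ?_⟩
    · refine Nat.succ_le_of_lt (lt_of_le_of_ne htn fun h => ?_)
      have := x.D.next_mem a t₀
      rw [← h] at this
      rcases this with h | h
      · exact hc'.2 h
      · exact absurd hc'.1 (not_le.2 h)
    · simp [eval, update_same, update_idem]
    · simp [eval, update_same]
      omega
  · exact ⟨t₀, le_rfl, x.D.le_next a t₀, (update_eq_self _ _ _).symm⟩
  · omega
  · simp only [cost]; omega
  · rintro _ ⟨t, ht, htn, rfl⟩ hc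
    suffices h : x.D.next a t₀ ≤ t by rw [le_antisymm htn h]
    refine x.D.next_le_of ht (or_iff_not_imp_right.2 fun h => ?_)
    have htτ : t ≤ x.τ := not_lt.1 h
    have hb := ha.bit t (by omega) htτ
    simp [eval, update_same, update_of_ne, hτ] at hc
    rw [hb] at hc
    by_contra hmem
    rw [if_neg hmem] at hc
    omega

theorem runs_shiftCode {τ : ℕ} (hτ : σ 0 2 = τ) :
    Runs shiftCode σ (32 * (τ + 1)) fun σ' =>
      σ' = (σ.update vCode 0 (2 ^ (τ + 1) * σ vCode 0)).update vK 0 (τ + 1) := by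
  refine Runs.set_seq (T₂ := 21 * (τ + 1) + 8) (by simp [cost]; omega) ?_
  simp only [eval]
  refine Runs.loop (fun σ' => ∃ i ≤ τ + 1,
      σ' = (σ.update vCode 0 (2 ^ i * σ vCode 0)).update vK 0 i)
    (fun σ' => τ + 1 - σ' vK 0) (τ + 1) (T₁ := 13) ?_ ?_ ?_ ?_ ?_
  · rintro _ ⟨i, hi, rfl⟩ hc
    have hi' : i < τ + 1 := by
      simp [eval, update_same, update_of_ne, hτ] at hc; omega
    refine Runs.set_seq (T₂ := 6) (by simp [cost]) (Runs.set (by simp [cost]) ⟨⟨i + 1, hi', ?_⟩, ?_⟩)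
    · simp [eval, update_same, update_of_ne]
      rw [update_comm (k := vK) (l := vCode) (by decide), update_idem, update_idem]
      congr 2
      ring
    · simp [eval, update_same, update_of_ne]; omega
  · refine ⟨0, by omega, ?_⟩
    simp [update_eq_self]
  · omega
  · simp only [cost]; omega
  · rintro _ ⟨i, hi, rfl⟩ hc
    simp [eval, update_same, update_of_ne, hτ] at hc
    obtain rfl : i = τ + 1 := by omega
    rfl

theorem runs_advanceToken (hτ : σ 0 2 = x.τ) (ha : ArcAt x (σ 0) a (σ vArcPos 0)) {d : ℕ}
    (hd : σ arrTok (σ vHeadPos 0 + σ vJ 0) = d) (h1 : 1 ≤ d) (h2 : d ≤ 2 * x.τ + 1) :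
    Runs advanceToken σ (59 * (x.τ + 1) + 100) fun σ' =>
      (∀ k < 13, k ≠ arrTok → σ' k = σ k) ∧
      (∀ i, σ' arrTok i =
        if i = σ vLenPos 0 + σ vJ 0 then x.D.advance a d else σ arrTok i) ∧
      σ' vCode 0 = 2 ^ (x.τ + 1) * σ vCode 0 + x.D.advance a d ∧
      σ' vOk 0 = (if x.D.advance a d < x.τ + (σ vJ 0 + 1) then σ vOk 0 else 0) ∧
      σ' vJ 0 = σ vJ 0 + 1 := by
  -- `s` is the reduced time and `o` the shift, which is `τ` for a restarted token.
  obtain ⟨s, o, hs1, hs2, hadv, hso⟩ : ∃ s o, 1 ≤ s ∧ s ≤ x.τ + 1 ∧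
      x.D.next a s + o = x.D.advance a d ∧
      ((x.τ < d ∧ s = d - x.τ ∧ o = x.τ) ∨ (d ≤ x.τ ∧ s = d ∧ o = 0)) := by
    by_cases h : d ≤ x.τ
    · refine ⟨d, 0, h1, by omega, ?_, Or.inr ⟨h, rfl, rfl⟩⟩
      rw [TemporalDigraph.advance, if_pos (show d ≤ x.D.lifetime from h), Nat.add_zero]
    · refine ⟨d - x.τ, x.τ, by omega, by omega, ?_, Or.inl ⟨by omega, rfl, rfl⟩⟩
      rw [TemporalDigraph.advance, if_neg (show ¬ d ≤ x.D.lifetime from h), Nat.add_comm]; rfl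
  refine Runs.set_seq (T₂ := 59 * (x.τ + 1) + 90) (by simp [cost]; omega) ?_
  refine Runs.set_seq (T₂ := 59 * (x.τ + 1) + 87) (by simp [cost]; omega) ?_
  simp [eval, hd]
  refine Runs.seq (T₁ := 20) (T₂ := 59 * (x.τ + 1) + 67)
    (R := fun σ' => σ' = (σ.update vShift 0 o).update vTime 0 s) ?_ ?_ (by omega)
  · refine Runs.ite (T₁ := 14) ?_ ?_ (by simp [cost])
    · intro hc
      simp [eval, update_same, update_of_ne, hτ] at hc
      refine Runs.set_seq (T₂ := 10) (by simp [cost]) (Runs.set (by simp [cost]) ?_)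
      obtain ⟨-, rfl, rfl⟩ := hso.resolve_right (by omega)
      simp [eval, update_same, update_of_ne, update_idem, hτ]
      rw [update_comm (k := vTime) (l := vShift) (by decide), update_idem]
    · intro hc
      simp [eval, update_same, update_of_ne, hτ] at hc
      refine Runs.skip (by omega) ?_
      obtain ⟨-, rfl, rfl⟩ := hso.resolve_left (by omega)
      rw [update_comm (k := vTime) (l := vShift) (by decide)]
  rintro _ rfl
  refine Runs.seq (T₁ := 27 * (x.τ + 1)) (T₂ := 32 * (x.τ + 1) + 67)
    (R := fun σ' => σ' = (σ.update vShift 0 o).update vTime 0 (x.D.next a s)) ?_ ?_ (by omega)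
  · refine (runs_seekTime (x := x) (a := a) ?_ ?_ ?_ ?_).mono le_rfl ?_
    · simpa [update_same, update_of_ne] using hτ
    · simpa [update_same, update_of_ne] using ha
    · simpa [update_same] using hs1
    · simpa [update_same] using hs2
    · rintro _ rfl
      simp [update_same, update_idem]
  rintro _ rfl
  refine Runs.set_seq (T₂ := 32 * (x.τ + 1) + 56) (by simp [cost]; omega) ?_
  simp [eval, update_same, update_of_ne, hadv]
  refine Runs.seq (runs_shiftCode (τ := x.τ) ?_) (T₂ := 56) ?_ (by omega)
  · simpa [update_same, update_of_ne] using hτ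
  rintro _ rfl
  refine Runs.set_seq (T₂ := 44) (by simp [cost]) ?_
  simp [eval, update_same, update_of_ne]
  refine Runs.seq (T₁ := 20) (T₂ := 6)
    (R := fun σ' =>
      (∀ k < 14, k ≠ arrTok → σ' k = σ k) ∧
      (∀ i, σ' arrTok i =
        if i = σ vLenPos 0 + σ vJ 0 then x.D.advance a d else σ arrTok i) ∧
      σ' vCode 0 = 2 ^ (x.τ + 1) * σ vCode 0 + x.D.advance a d ∧
      σ' vOk 0 = (if x.D.advance a d < x.τ + (σ vJ 0 + 1) then σ vOk 0 else 0)) ?_ ?_ (by omega)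
  · have frame : ∀ k < 14, k ≠ 4 → ∀ l, 14 ≤ l → k ≠ l := by omega
    refine Runs.ite (T₁ := 3) ?_ ?_ (by simp [cost])
    · intro hc
      simp [eval, update_same, update_of_ne, hτ] at hc
      refine Runs.set (by simp [cost]) ⟨?_, ?_, ?_, ?_⟩
      · intro k hk hk'
        simp [update_of_ne, frame k hk hk', hk']
      · simp [update_same, update_of_ne, eval]
      · simp [update_same, update_of_ne, eval]
      · rw [if_neg (by omega)]
        simp [update_same, eval]
    · intro hc
      simp [eval, update_same, update_of_ne, hτ] at hc
      refine Runs.skip (by omega) ⟨?_, ?_, ?_, ?_⟩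
      · intro k hk hk'
        simp [update_of_ne, frame k hk hk', hk']
      · simp [update_same, update_of_ne]
      · simp [update_same]
      · rw [if_pos (by omega)]
        simp [update_of_ne]
  · rintro σ' ⟨hf, htok, hcode, hok⟩
    refine Runs.set (by simp [cost]) ⟨?_, ?_, ?_, ?_, ?_⟩
    · intro k hk hk'
      rw [update_of_ne (by omega)]
      exact hf k (by omega) hk'
    · simpa [update_same, update_of_ne] using htok
    · simpa [update_same, update_of_ne] using hcode
    · simpa [update_same, update_of_ne] using hok
    · simp [update_same, eval, hf]

/-- The value of the digits `f 0, …, f (k - 1)` after the leading digit `c`, in base `B`. -/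
def horner (B c : ℕ) (f : ℕ → ℕ) : ℕ → ℕ
  | 0 => c
  | k + 1 => B * horner B c f k + f k

theorem horner_congr {B c : ℕ} {f g : ℕ → ℕ} {k : ℕ} (h : ∀ j < k, f j = g j) :
    horner B c f k = horner B c g k := by
  induction k with
  | zero => rfl
  | succ k ih => rw [horner, horner, ih fun j hj => h j (by omega), h k (by omega)]

theorem horner_inj {B c c' : ℕ} {f g : ℕ → ℕ} {k : ℕ} (hf : ∀ j < k, f j < B)
    (hg : ∀ j < k, g j < B) (h : horner B c f k = horner B c' g k) :
    c = c' ∧ ∀ j < k, f j = g j := by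
  induction k with
  | zero => exact ⟨h, by simp⟩
  | succ k ih =>
    have hfk := hf k (by omega)
    have hgk := hg k (by omega)
    have hB : 0 < B := by omega
    rw [horner, horner] at h
    have hmod : f k = g k := by
      have := congrArg (· % B) h
      simpa [Nat.mul_add_mod, Nat.mod_eq_of_lt, hfk, hgk] using this
    have hdiv : horner B c f k = horner B c' g k :=
      Nat.eq_of_mul_eq_mul_left hB (by omega)
    obtain ⟨h1, h2⟩ := ih (fun j hj => hf j (by omega)) (fun j hj => hg j (by omega)) hdiv
    refine ⟨h1, fun j hj => ?_⟩
    rcases Nat.lt_succ_iff_lt_or_eq.1 hj with hj | rfl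
    exacts [h2 j hj, hmod]

theorem horner_eq_add {B c : ℕ} {f : ℕ → ℕ} {k : ℕ} (hf : ∀ j < k, f j < B) :
    ∃ r < B ^ k, horner B c f k = c * B ^ k + r := by
  induction k with
  | zero => exact ⟨0, by simp, by simp [horner]⟩
  | succ k ih =>
    obtain ⟨r, hr, h⟩ := ih fun j hj => hf j (by omega)
    have hfk := hf k (by omega)
    refine ⟨B * r + f k, ?_, ?_⟩
    · calc B * r + f k < B * r + B := by omega
        _ = B * (r + 1) := by ring
        _ ≤ B * B ^ k := Nat.mul_le_mul_left _ hr
        _ = B ^ (k + 1) := by ring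
    · rw [horner, h]; ring

theorem runs_advanceTokens (hτ : σ 0 2 = x.τ) (ha : ArcAt x (σ 0) a (σ vArcPos 0))
    (hpos : σ vHeadPos 0 + (x.τ + 1) ≤ σ vLenPos 0) {f : ℕ → ℕ}
    (hf : ∀ j ≤ x.τ, σ arrTok (σ vHeadPos 0 + j) = f j ∧ 1 ≤ f j ∧ f j ≤ 2 * x.τ + 1) :
    Runs advanceTokens σ (180 * (x.τ + 1) ^ 2) fun σ' =>
      (∀ k < 13, k ≠ arrTok → σ' k = σ k) ∧
      (∀ i < σ vLenPos 0, σ' arrTok i = σ arrTok i) ∧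
      (∀ j ≤ x.τ, σ' arrTok (σ vLenPos 0 + j) = x.D.advance a (f j)) ∧
      σ' vCode 0 = horner (2 ^ (x.τ + 1)) (σ vCode 0) (fun j => x.D.advance a (f j)) (x.τ + 1) ∧
      σ' vOk 0 =
        if ∀ j < x.τ + 1, x.D.advance a (f j) < x.τ + (j + 1) then σ vOk 0 else 0 := by
  refine Runs.set_seq (T₂ := (x.τ + 1) * (59 * (x.τ + 1) + 108) + 8)
    (by simp [cost]; nlinarith [sq_nonneg x.τ]) ?_
  refine Runs.loop (fun σ' => σ' vJ 0 ≤ x.τ + 1 ∧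
      (∀ k < 13, k ≠ arrTok → σ' k = σ k) ∧
      (∀ i < σ vLenPos 0, σ' arrTok i = σ arrTok i) ∧
      (∀ j < σ' vJ 0, σ' arrTok (σ vLenPos 0 + j) = x.D.advance a (f j)) ∧
      σ' vCode 0 = horner (2 ^ (x.τ + 1)) (σ vCode 0) (fun j => x.D.advance a (f j)) (σ' vJ 0) ∧
      σ' vOk 0 =
        if ∀ j < σ' vJ 0, x.D.advance a (f j) < x.τ + (j + 1) then σ vOk 0 else 0)
    (fun σ' => x.τ + 1 - σ' vJ 0) (x.τ + 1) (T₁ := 59 * (x.τ + 1) + 100) ?_ ?_ ?_ ?_ ?_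
  · rintro σ' ⟨hj, hfr, hlow, htok, hcode, hok⟩ hc
    have h0 := hfr 0 (by decide) (by decide)
    simp [eval, h0, hτ] at hc
    obtain ⟨hf1, hf2, hf3⟩ := hf (σ' vJ 0) (by omega)
    have e9 := hfr 9 (by decide) (by decide)
    have e10 := hfr 10 (by decide) (by decide)
    have e11 := hfr 11 (by decide) (by decide)
    refine (runs_advanceToken (x := x) (a := a) (d := f (σ' vJ 0)) (by rw [h0, hτ])
      (by rw [h0, e11]; exact ha) ?_ hf2 hf3).mono le_rfl ?_
    · rw [e9, hlow _ (by omega), hf1]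
    · rintro σ'' ⟨hfr', htok', hcode', hok', hj'⟩
      rw [e10] at htok'
      refine ⟨⟨by omega, fun k hk hk' => (hfr' k hk hk').trans (hfr k hk hk'), ?_, ?_, ?_, ?_⟩,
        by omega⟩
      · intro i hi
        rw [htok', if_neg (by omega), hlow i hi]
      · intro j hj
        rw [htok']
        split_ifs with h
        · rw [show j = σ' vJ 0 by omega]
        · exact htok j (by omega)
      · rw [hcode', hj', hcode, horner]
      · rw [hok', hj', hok]
        simp only [Nat.lt_succ_iff_lt_or_eq, or_imp, forall_and, forall_eq]
        split_ifs <;> tauto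
  · simp [eval, update_same, update_of_ne, horner]
    intro k hk hk'
    rw [update_of_ne (by omega)]
  · simp
  · simp only [cost]; rfl
  · rintro σ' ⟨hj, hfr, hlow, htok, hcode, hok⟩ hc
    have h0 := hfr 0 (by decide) (by decide)
    simp [eval, h0, hτ] at hc
    have hj' : σ' vJ 0 = x.τ + 1 := by omega
    rw [hj'] at htok hcode hok
    exact ⟨hfr, hlow, fun j hj => htok j (by omega), hcode, hok⟩

end RAM

/-! ### The input -/

namespace RAM

open RAM.Expr RAM.Prog

/-- Random access to a concatenation of blocks of equal length `w`. -/
theorem getD_flatMap {α : Type*} (l : List α) (f : α → List ℕ) {w : ℕ}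
    (hw : ∀ a, (f a).length = w) {i r : ℕ} (hi : i < l.length) (hr : r < w) :
    (l.flatMap f).getD (i * w + r) 0 = (f l[i]).getD r 0 := by
  induction l generalizing i with
  | nil => simp at hi
  | cons a l ih =>
    cases i with
    | zero => simpa using List.getD_append _ _ _ _ (by rw [hw]; omega)
    | succ i =>
      rw [List.flatMap_cons, List.getD_append_right _ _ _ _ (by rw [hw]; nlinarith), hw,
        show (i + 1) * w + r - w = i * w + r by rw [Nat.succ_mul]; omega]
      simpa using ih (by simpa using hi)

/-- After the three numbers `n`, `m`, `τ`, the input consists of blocks of length `τ + 2`. -/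
theorem arcAt_initial (x : CycleInstance) {k : ℕ} (hk : k < x.arcs.length) :
    ArcAt x (initial x.encode 0) x.arcs[k] (3 + k * (x.τ + 2)) := by
  have key : ∀ r, r < x.τ + 2 → initial x.encode 0 (3 + k * (x.τ + 2) + r) =
      (((x.arcs[k].1 : ℕ) :: (x.arcs[k].2 : ℕ) :: (List.range x.τ).map fun i =>
        if i + 1 ∈ x.D.time x.arcs[k].1 x.arcs[k].2 then 1 else 0)).getD r 0 := by
    intro r hr
    rw [← getD_flatMap x.arcs (fun a => (a.1 : ℕ) :: (a.2 : ℕ) ::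
      (List.range x.τ).map fun i => if i + 1 ∈ x.D.time a.1 a.2 then 1 else 0)
      (w := x.τ + 2) (by simp) hk hr, add_assoc, add_comm 3]
    rfl
  refine ⟨?_, ?_, ?_⟩
  · simpa using key 0 (by omega)
  · simpa using key 1 (by omega)
  · intro t h1 h2
    obtain ⟨t, rfl⟩ := Nat.exists_eq_add_of_le' h1
    rw [add_assoc, show 1 + (t + 1) = t + 2 by ring, key (t + 2) (by omega)]
    simp [show t < x.τ by omega]

/-! ### States of the search -/

/-- A state of the search: the first and the last vertex of a walk, and the positions of the tokens
`1, …, τ + 1` after this walk.  Token `j + 1` has index `j`; indices beyond `τ` carry the value `0`. -/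
@[ext] structure SearchState (x : CycleInstance) where
  start : Fin x.n
  cur : Fin x.n
  tok : ℕ → ℕ

namespace SearchState

variable {x : CycleInstance}

/-- The state of the walk from `s` to `v` with the arcs `L`. -/
def ofWalk (s v : Fin x.n) (L : List (Fin x.n × Fin x.n)) : SearchState x :=
  ⟨s, v, fun j => if j ≤ x.τ then x.D.token L (j + 1) else 0⟩

/-- The state after the walk has been extended by the arc `a`. -/
def step (a : Fin x.n × Fin x.n) (st : SearchState x) : SearchState x :=
  ⟨st.start, a.2, fun j => if j ≤ x.τ then x.D.advance a (st.tok j) else 0⟩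

/-- States of actual walks. -/
def Reachable (st : SearchState x) : Prop := ∃ L, x.D.Walk st.start st.cur L ∧
  st = ofWalk st.start st.cur L

/-- The walk is closed, and its tokens show it to be strong. -/
def Accepting (st : SearchState x) : Prop :=
  st.start = st.cur ∧ ∀ j < x.τ + 1, st.tok j < x.τ + (j + 1)

/-- The index of a state in the array of marks. -/
def code (st : SearchState x) : ℕ :=
  horner (2 ^ (x.τ + 1)) (st.start * x.n + st.cur) st.tok (x.τ + 1)

theorem step_ofWalk (s u : Fin x.n) (L : List (Fin x.n × Fin x.n)) (a : Fin x.n × Fin x.n) :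
    step a (ofWalk s u L) = ofWalk s a.2 (L ++ [a]) := by
  ext1
  · rfl
  · rfl
  · funext j
    by_cases h : j ≤ x.τ <;> simp [step, ofWalk, h, TemporalDigraph.token_append]

theorem reachable_ofWalk {s v : Fin x.n} {L : List (Fin x.n × Fin x.n)} (h : x.D.Walk s v L) :
    Reachable (ofWalk s v L) := ⟨L, h, rfl⟩

theorem Reachable.step {st : SearchState x} (h : st.Reachable) {a : Fin x.n × Fin x.n}
    (ha : a ∈ x.arcs) (hc : a.1 = st.cur) : (step a st).Reachable := by
  obtain ⟨L, hw, he⟩ := h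
  rw [he, step_ofWalk]
  exact reachable_ofWalk (TemporalDigraph.walk_append.2 ⟨_, hw, hc, (x.mem_arcs a).1 ha, rfl⟩)

theorem Reachable.tok_bounds {st : SearchState x} (h : st.Reachable) {j : ℕ} (hj : j ≤ x.τ) :
    1 ≤ st.tok j ∧ st.tok j ≤ 2 * x.τ + 1 := by
  obtain ⟨L, -, he⟩ := h
  rw [he]
  simp only [ofWalk, if_pos hj]
  exact x.D.token_bounds L (by omega) (show j + 1 ≤ 2 * x.τ + 1 by omega)

theorem Reachable.tok_lt {st : SearchState x} (h : st.Reachable) {j : ℕ} (hj : j < x.τ + 1) :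
    st.tok j < 2 ^ (x.τ + 1) := by
  have h1 := (h.tok_bounds (Nat.lt_succ_iff.1 hj)).2
  have h2 : x.τ < 2 ^ x.τ := Nat.lt_two_pow_self
  rw [pow_succ]; omega

/-- Codes are injective on states of walks, whose tokens are digits in base `2 ^ (τ + 1)`. -/
theorem Reachable.ext_code {st st' : SearchState x} (h : st.Reachable) (h' : st'.Reachable)
    (hc : st.code = st'.code) : st = st' := by
  obtain ⟨h1, h2⟩ := horner_inj (fun j hj => h.tok_lt hj) (fun j hj => h'.tok_lt hj) hc
  have hn : 0 < x.n := st.start.pos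
  have h3 : st.cur.1 = st'.cur.1 := by
    have := congrArg (· % x.n) h1
    simpa [Nat.mul_add_mod', Nat.mod_eq_of_lt] using this
  have h4 : st.start.1 = st'.start.1 :=
    Nat.eq_of_mul_eq_mul_right hn (by omega)
  ext1
  · exact Fin.ext h4
  · exact Fin.ext h3
  · funext j
    by_cases hj : j < x.τ + 1
    · exact h2 j hj
    · obtain ⟨L, -, he⟩ := h
      obtain ⟨L', -, he'⟩ := h'
      rw [he, he']
      simp only [ofWalk]
      rw [if_neg (by omega), if_neg (by omega)]

variable (x) in
/-- A set containing the codes of all states that are successors of reachable states. -/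
def codes : Finset ℕ :=
  ((Finset.univ : Finset (Fin x.n)) ×ˢ x.arcs.toFinset ×ˢ
      Finset.range (2 ^ (x.τ + 1) ^ 2)).image
    fun p => (p.1 * x.n + p.2.1.2) * 2 ^ (x.τ + 1) ^ 2 + p.2.2

variable (x) in
theorem card_codes_le : (codes x).card ≤ x.n * x.m * 2 ^ (x.τ + 1) ^ 2 := by
  refine Finset.card_image_le.trans ?_
  rw [Finset.card_product, Finset.card_product, Finset.card_range, Finset.card_fin, mul_assoc]
  gcongr
  exact List.toFinset_card_le _

theorem Reachable.code_step_mem {st : SearchState x} (h : st.Reachable) {a : Fin x.n × Fin x.n}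
    (ha : a ∈ x.arcs) (hc : a.1 = st.cur) : (SearchState.step a st).code ∈ codes x := by
  obtain ⟨r, hr, he⟩ := horner_eq_add (c := st.start * x.n + a.2)
    (fun j hj => (h.step ha hc).tok_lt hj)
  rw [← pow_mul, ← sq] at hr he
  refine Finset.mem_image.2 ⟨(st.start, a, r), ?_, he.symm⟩
  simp [ha, hr]

/-- Strong cycles correspond to the accepting states that are successors of reachable states. -/
theorem hasStrongCycle_iff_accepting (hτ : 1 ≤ x.τ) : x.HasStrongCycle ↔
    ∃ (st : SearchState x) (a : Fin x.n × Fin x.n), st.Reachable ∧ a ∈ x.arcs ∧ a.1 = st.cur ∧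
      (SearchState.step a st).Accepting := by
  rw [CycleInstance.HasStrongCycle, TemporalDigraph.hasStrongCycle_iff]
  constructor
  · rintro ⟨v, L, h0, hw, hs⟩
    obtain ⟨L, a, rfl⟩ : ∃ L' a, L = L' ++ [a] := ⟨_, _, (List.dropLast_append_getLast h0).symm⟩
    have htok := (TemporalDigraph.strong_iff_token hτ hw.adj).1 hs
    obtain ⟨u, hu, hau, hadj, hv⟩ := TemporalDigraph.walk_append.1 hw
    refine ⟨ofWalk v u L, a, reachable_ofWalk hu, (x.mem_arcs a).2 hadj, hau, ?_⟩
    rw [step_ofWalk]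
    refine ⟨hv.symm, fun j hj => ?_⟩
    simp only [ofWalk, if_pos (Nat.lt_succ_iff.1 hj)]
    exact htok (j + 1) (by omega) hj
  · rintro ⟨st, a, ⟨L, hw, he⟩, ha, hc, hacc⟩
    rw [he, step_ofWalk] at hacc
    have hw' : x.D.Walk st.start a.2 (L ++ [a]) :=
      TemporalDigraph.walk_append.2 ⟨_, hw, hc, (x.mem_arcs a).1 ha, rfl⟩
    obtain ⟨h1, h2⟩ := hacc
    simp only [ofWalk] at h1 h2
    rw [← h1] at hw'
    refine ⟨st.start, _, by simp, hw', (TemporalDigraph.strong_iff_token hτ hw'.adj).2 ?_⟩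
    intro d hd hd'
    obtain ⟨j, rfl⟩ := Nat.exists_eq_add_of_le' hd
    have hj : j < x.τ + 1 := hd'
    have := h2 j hj
    rwa [if_pos (Nat.lt_succ_iff.1 hj)] at this

/-- The state is stored as entry `i` of the queue. -/
structure Stored (σ : Memory) (i : ℕ) (st : SearchState x) : Prop where
  start : σ arrStart i = st.start
  cur : σ arrCur i = st.cur
  base : σ arrBase i = st.start * x.n
  tok : ∀ j ≤ x.τ, σ arrTok (i * (x.τ + 1) + j) = st.tok j

end SearchState

open SearchState

/-! ### Correctness of the search -/

variable {x : CycleInstance}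

/-- The arc `a` has been taken into account for the state `st`. -/
def Done (σ : Memory) (Q : List (SearchState x)) (st : SearchState x) (a : Fin x.n × Fin x.n) :
    Prop :=
  a.1 = st.cur → st.step a ∈ Q ∧ ((st.step a).Accepting → σ 1 0 = 1)

/-- The invariant of the search: the queue holds the states `Q`, the first `i` of which have been
processed. -/
structure SearchInv (σ : Memory) (Q : List (SearchState x)) (i : ℕ) : Prop where
  input : σ 0 = initial x.encode 0
  head : σ vHead 0 = i
  headPos : σ vHeadPos 0 = i * (x.τ + 1)
  len : σ vLen 0 = Q.length
  lenPos : σ vLenPos 0 = Q.length * (x.τ + 1)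
  stored : ∀ (j : ℕ) (st : SearchState x), Q[j]? = some st → st.Stored σ j
  init_mem : ∀ s, ofWalk s s [] ∈ Q
  reachable : ∀ st ∈ Q, st.Reachable
  marked : ∀ c, σ arrMark c ≠ 0 → ∃ st ∈ Q, st.code = c
  -- Each entry beyond the first `n` is accounted for by a marked code.
  count : Q.length ≤ x.n + ((codes x).filter fun c => σ arrMark c ≠ 0).card
  answer : σ 1 0 = 0 ∨ σ 1 0 = 1 ∧ ∃ (st : SearchState x) (a : Fin x.n × Fin x.n),
    st.Reachable ∧ a ∈ x.arcs ∧ a.1 = st.cur ∧ (st.step a).Accepting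
  done : ∀ j < i, ∀ st : SearchState x, Q[j]? = some st → ∀ a ∈ x.arcs, Done σ Q st a

theorem SearchInv.length_le {σ : Memory} {Q : List (SearchState x)} {i : ℕ}
    (h : SearchInv σ Q i) : Q.length ≤ x.n + x.n * x.m * 2 ^ (x.τ + 1) ^ 2 :=
  h.count.trans (Nat.add_le_add_left ((Finset.card_filter_le _ _).trans (card_codes_le x)) _)

theorem runs_generate {σ : Memory} {Q : List (SearchState x)} {i : ℕ} (h : SearchInv σ Q i)
    {st : SearchState x} (hst : Q[i]? = some st) {a : Fin x.n × Fin x.n}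
    (ha : ArcAt x (σ 0) a (σ vArcPos 0)) :
    Runs generate σ (180 * (x.τ + 1) ^ 2 + 80) fun σ' =>
      (∀ k < 13, k ≠ arrStart → k ≠ arrCur → k ≠ arrTok → k ≠ arrBase → σ' k = σ k) ∧
      (st.step a).Stored σ' Q.length ∧
      (∀ j < Q.length, ∀ st' : SearchState x, st'.Stored σ j → st'.Stored σ' j) ∧
      σ' vCode 0 = (st.step a).code ∧ (σ' vOk 0 ≠ 0 ↔ (st.step a).Accepting) := by
  have hi : i < Q.length := (List.getElem?_eq_some_iff.1 hst).1
  have hmem : st ∈ Q := List.mem_of_getElem? hst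
  have hS := h.stored i st hst
  have hτ : σ 0 2 = x.τ := by rw [h.input]; rfl
  refine Runs.set_seq (T₂ := 180 * (x.τ + 1) ^ 2 + 74) (by simp [cost]; omega) ?_
  refine Runs.set_seq (T₂ := 180 * (x.τ + 1) ^ 2 + 66) (by simp [cost]; omega) ?_
  refine Runs.set_seq (T₂ := 180 * (x.τ + 1) ^ 2 + 60) (by simp [cost]; omega) ?_
  refine Runs.set_seq (T₂ := 180 * (x.τ + 1) ^ 2 + 50) (by simp [cost]; omega) ?_
  refine Runs.set_seq (T₂ := 180 * (x.τ + 1) ^ 2) (by simp [cost]; omega) ?_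
  simp only [eval, update_same, update_of_ne, ne_eq, OfNat.zero_ne_ofNat, Nat.reduceEqDiff,
    not_false_eq_true, if_true, h.len, h.head, hS.start, hS.base, ha.head]
  have hpos : i * (x.τ + 1) + (x.τ + 1) ≤ Q.length * (x.τ + 1) := by
    rw [← Nat.succ_mul]; exact Nat.mul_le_mul_right _ hi
  refine (runs_advanceTokens (x := x) (a := a) (f := st.tok) ?_ ?_ ?_ ?_).mono le_rfl ?_
  · simpa [update_of_ne] using hτ
  · simpa [update_of_ne] using ha
  · simpa [update_of_ne, h.headPos, h.lenPos] using hpos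
  · intro j hj
    refine ⟨?_, (h.reachable st hmem).tok_bounds hj⟩
    simpa [update_of_ne, h.headPos] using hS.tok j hj
  · rintro σ' ⟨hfr, hlow, htok, hcode, hok⟩
    simp only [update_same, update_of_ne, ne_eq, Nat.reduceEqDiff, not_false_eq_true, if_true,
      h.lenPos] at hlow htok hcode hok
    refine ⟨?_, ⟨?_, ?_, ?_, ?_⟩, ?_, ?_, ?_⟩
    · intro k hk h2 h3 h4 h6
      rw [hfr k hk h4]
      simp [update_of_ne, h2, h3, h6, show k ≠ 16 by omega, show k ≠ 18 by omega]
    · simp [hfr, update_same, update_of_ne, step]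
    · simp [hfr, update_same, update_of_ne, step]
    · simp [hfr, update_same, update_of_ne, step]
    · intro j hj
      rw [htok j hj]
      simp [step, hj]
    · intro j hj st' hS'
      refine ⟨?_, ?_, ?_, ?_⟩
      · simp [hfr, update_same, update_of_ne, hj.ne, hS'.start]
      · simp [hfr, update_same, update_of_ne, hj.ne, hS'.cur]
      · simp [hfr, update_same, update_of_ne, hj.ne, hS'.base]
      · intro k hk
        have : j * (x.τ + 1) + (x.τ + 1) ≤ Q.length * (x.τ + 1) := by
          rw [← Nat.succ_mul]; exact Nat.mul_le_mul_right _ hj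
        rw [hlow _ (by omega), hS'.tok k hk]
    · rw [hcode, code]
      refine horner_congr fun j hj => ?_
      simp [step, Nat.lt_succ_iff.1 hj]
    · have e : (∀ j < x.τ + 1, x.D.advance a (st.tok j) < x.τ + (j + 1)) ↔
          ∀ j < x.τ + 1, (st.step a).tok j < x.τ + (j + 1) := by
        refine forall₂_congr fun j hj => ?_
        simp [step, Nat.lt_succ_iff.1 hj]
      rw [hok, Accepting, ← e]
      have e2 : (step a st).start = (step a st).cur ↔ (st.start : ℕ) = a.2 := Fin.ext_iff
      rw [e2]
      split_ifs with hall
      · rw [and_iff_left hall]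
        omega
      · exact iff_of_false (by simp) fun hA => hall hA.2

theorem Done.mono {σ σ' : Memory} {Q Q' : List (SearchState x)} {st : SearchState x}
    {a : Fin x.n × Fin x.n} (h : Done σ Q st a) (hQ : ∀ st ∈ Q, st ∈ Q')
    (hσ : σ 1 0 = 1 → σ' 1 0 = 1) : Done σ' Q' st a :=
  fun hc => ⟨hQ _ (h hc).1, fun hacc => hσ ((h hc).2 hacc)⟩

/-- Memories that agree on the data of the search satisfy the same invariant. -/
theorem SearchInv.congr {σ σ' : Memory} {Q : List (SearchState x)} {i : ℕ} (h : SearchInv σ Q i)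
    (hσ : ∀ k < 11, σ' k = σ k) : SearchInv σ' Q i := by
  have h0 := hσ 0 (by decide)
  have h1 := hσ 1 (by decide)
  have h2 := hσ 2 (by decide)
  have h3 := hσ 3 (by decide)
  have h4 := hσ 4 (by decide)
  have h5 := hσ 5 (by decide)
  have h6 := hσ 6 (by decide)
  have h7 := hσ 7 (by decide)
  have h8 := hσ 8 (by decide)
  have h9 := hσ 9 (by decide)
  have h10 := hσ 10 (by decide)
  exact
    { input := h0 ▸ h.input
      head := h7 ▸ h.head
      headPos := h9 ▸ h.headPos
      len := h8 ▸ h.len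
      lenPos := h10 ▸ h.lenPos
      stored := fun j st hj =>
        have hS := h.stored j st hj
        ⟨h2 ▸ hS.start, h3 ▸ hS.cur, h6 ▸ hS.base, h4 ▸ hS.tok⟩
      init_mem := h.init_mem
      reachable := h.reachable
      marked := h5 ▸ h.marked
      count := h5 ▸ h.count
      answer := h1 ▸ h.answer
      done := fun j hj st hst a ha =>
        (h.done j hj st hst a ha).mono (fun _ => id) fun he => by rw [h1, he] }

theorem runs_register {σ σ₁ : Memory} {Q : List (SearchState x)} {i : ℕ} (h : SearchInv σ Q i)
    {st : SearchState x} (hst : Q[i]? = some st) {a : Fin x.n × Fin x.n} (ha : a ∈ x.arcs)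
    (hc : a.1 = st.cur)
    (hfr : ∀ k < 13, k ≠ arrStart → k ≠ arrCur → k ≠ arrTok → k ≠ arrBase → σ₁ k = σ k)
    (hnew : (st.step a).Stored σ₁ Q.length)
    (hold : ∀ j < Q.length, ∀ st' : SearchState x, st'.Stored σ j → st'.Stored σ₁ j)
    (hcode : σ₁ vCode 0 = (st.step a).code) (hok : σ₁ vOk 0 ≠ 0 ↔ (st.step a).Accepting) :
    Runs register σ₁ 50 fun σ' => ∃ Q', SearchInv σ' Q' i ∧ Q'[i]? = some st ∧
      σ' vArc = σ vArc ∧ σ' vArcPos = σ vArcPos ∧ Done σ' Q' st a ∧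
      ∀ st' a', Done σ Q st' a' → Done σ' Q' st' a' := by
  have hi : i < Q.length := (List.getElem?_eq_some_iff.1 hst).1
  have hreach := h.reachable st (List.mem_of_getElem? hst)
  have e0 := hfr 0 (by decide) (by decide) (by decide) (by decide) (by decide)
  have e1 := hfr 1 (by decide) (by decide) (by decide) (by decide) (by decide)
  have e5 := hfr 5 (by decide) (by decide) (by decide) (by decide) (by decide)
  have e7 := hfr 7 (by decide) (by decide) (by decide) (by decide) (by decide)
  have e8 := hfr 8 (by decide) (by decide) (by decide) (by decide) (by decide)
  have e9 := hfr 9 (by decide) (by decide) (by decide) (by decide) (by decide)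
  have e10 := hfr 10 (by decide) (by decide) (by decide) (by decide) (by decide)
  have e11 := hfr 11 (by decide) (by decide) (by decide) (by decide) (by decide)
  have e12 := hfr 12 (by decide) (by decide) (by decide) (by decide) (by decide)
  refine Runs.seq (T₁ := 20) (T₂ := 30)
    (R := fun σ₂ => (∀ k < 17, k ≠ 1 → σ₂ k = σ₁ k) ∧ (σ 1 0 = 1 → σ₂ 1 0 = 1) ∧
      ((st.step a).Accepting → σ₂ 1 0 = 1) ∧
      (σ₂ 1 0 = 0 ∨ σ₂ 1 0 = 1 ∧ ∃ (st : SearchState x) (a : Fin x.n × Fin x.n),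
        st.Reachable ∧ a ∈ x.arcs ∧ a.1 = st.cur ∧ (st.step a).Accepting)) ?_ ?_ (by omega)
  · refine Runs.ite (T₁ := 3) (fun hne => ?_) (fun he => ?_) (by simp [cost])
    · have hacc := hok.1 hne
      refine Runs.set (by simp [cost]) ⟨fun k _ hk => by rw [update_of_ne hk], ?_, ?_, Or.inr ⟨?_, ?_⟩⟩
      · simp [eval, update_same]
      · simp [eval, update_same]
      · simp [eval, update_same]
      · exact ⟨st, a, hreach, ha, hc, hacc⟩
    · refine Runs.skip (by omega) ⟨fun _ _ _ => rfl, by rw [e1]; exact id, ?_, by rw [e1]; exact h.answer⟩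
      exact fun hacc => absurd he (hok.2 hacc)
  rintro σ₂ ⟨hf₂, hone, hacc, hans⟩
  have hStored : ∀ (j : ℕ) (st' : SearchState x), st'.Stored σ₁ j → st'.Stored σ₂ j := by
    intro j st' hS
    refine ⟨?_, ?_, ?_, ?_⟩
    · rw [hf₂ 2 (by decide) (by decide), hS.start]
    · rw [hf₂ 3 (by decide) (by decide), hS.cur]
    · rw [hf₂ 6 (by decide) (by decide), hS.base]
    · rw [hf₂ 4 (by decide) (by decide)]; exact hS.tok
  have g0 : σ₂ 0 = σ 0 := (hf₂ 0 (by decide) (by decide)).trans e0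
  have g5 : σ₂ 5 = σ 5 := (hf₂ 5 (by decide) (by decide)).trans e5
  have g7 : σ₂ 7 = σ 7 := (hf₂ 7 (by decide) (by decide)).trans e7
  have g8 : σ₂ 8 = σ 8 := (hf₂ 8 (by decide) (by decide)).trans e8
  have g9 : σ₂ 9 = σ 9 := (hf₂ 9 (by decide) (by decide)).trans e9
  have g10 : σ₂ 10 = σ 10 := (hf₂ 10 (by decide) (by decide)).trans e10
  have g11 : σ₂ 11 = σ 11 := (hf₂ 11 (by decide) (by decide)).trans e11
  have g12 : σ₂ 12 = σ 12 := (hf₂ 12 (by decide) (by decide)).trans e12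
  have gcode : σ₂ vCode 0 = (st.step a).code := by rw [hf₂ 16 (by decide) (by decide), hcode]
  refine Runs.ite (T₁ := 26) (fun hne => ?_) (fun he => ?_) (by simp [cost])
  · simp only [eval, gcode, g5] at hne
    obtain ⟨st', hst', hcode'⟩ := h.marked _ hne
    have heq : st' = st.step a :=
      (h.reachable st' hst').ext_code (hreach.step ha hc) hcode'
    refine Runs.skip (by omega) ⟨Q, ?_, hst, g12, g11, fun _ => ⟨heq ▸ hst', hacc⟩,
      fun _ _ hd => hd.mono (fun _ => id) hone⟩
    exact
      { input := g0 ▸ h.input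
        head := g7 ▸ h.head
        headPos := g9 ▸ h.headPos
        len := g8 ▸ h.len
        lenPos := g10 ▸ h.lenPos
        stored := fun j st' hj => hStored _ _
          (hold j (List.getElem?_eq_some_iff.1 hj).1 st' (h.stored j st' hj))
        init_mem := h.init_mem
        reachable := h.reachable
        marked := g5 ▸ h.marked
        count := g5 ▸ h.count
        answer := hans
        done := fun j hj st' hst' a' ha' =>
          (h.done j hj st' hst' a' ha').mono (fun _ => id) hone }
  · simp only [eval, gcode, g5] at he
    refine Runs.set_seq (T₂ := 20) (by simp [cost]) ?_
    refine Runs.set_seq (T₂ := 12) (by simp [cost]) ?_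
    refine Runs.set (by simp [cost]) ?_
    simp only [eval, update_of_ne, ne_eq, OfNat.zero_ne_ofNat, Nat.reduceEqDiff,
      not_false_eq_true, gcode, g0, g8, g10]
    have hmono : ∀ st' ∈ Q, st' ∈ Q ++ [st.step a] := fun _ => List.mem_append_left _
    have hone' : σ 1 0 = 1 → (((σ₂.update 5 (step a st).code 1).update 8 0 (σ 8 0 + 1)).update 10 0
        (σ 10 0 + (σ 0 2 + 1))) 1 0 = 1 := by simpa [update_of_ne] using hone
    have hτ : σ 0 2 = x.τ := by rw [h.input]; rfl
    refine ⟨Q ++ [st.step a], ?_, ?_, ?_, ?_, ?_, fun _ _ hd => hd.mono hmono hone'⟩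
    · exact
        { input := by simpa [update_of_ne, g0] using h.input
          head := by simpa [update_of_ne, g7] using h.head
          headPos := by simpa [update_of_ne, g9] using h.headPos
          len := by simp [update_same, update_of_ne, h.len]
          lenPos := by simp [update_same, h.lenPos, hτ, Nat.succ_mul]
          stored := by
            intro j st' hj
            have hS : st'.Stored σ₂ j := by
              rcases Nat.lt_or_ge j Q.length with hlt | hge
              · rw [List.getElem?_append_left hlt] at hj
                exact hStored _ _ (hold j hlt st' (h.stored j st' hj))
              · rw [List.getElem?_append_right hge, List.getElem?_singleton] at hj
                split_ifs at hj with hj0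
                obtain rfl : j = Q.length := by omega
                obtain rfl := Option.some.inj hj
                exact hStored _ _ hnew
            refine ⟨?_, ?_, ?_, ?_⟩
            · simpa [update_of_ne] using hS.start
            · simpa [update_of_ne] using hS.cur
            · simpa [update_of_ne] using hS.base
            · simpa [update_of_ne] using hS.tok
          init_mem := fun s => hmono _ (h.init_mem s)
          reachable := by
            intro st' hst'
            rcases List.mem_append.1 hst' with hst' | hst'
            · exact h.reachable st' hst'
            · rw [List.mem_singleton.1 hst']
              exact hreach.step ha hc
          marked := by
            intro c hcm
            simp only [update_of_ne, update_same, ne_eq, Nat.reduceEqDiff, not_false_eq_true,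
              g5] at hcm
            split_ifs at hcm with hcc
            · exact ⟨_, by simp, hcc.symm⟩
            · obtain ⟨st', hst', hc'⟩ := h.marked c hcm
              exact ⟨st', hmono _ hst', hc'⟩
          count := by
            have hlt : ((codes x).filter fun c => σ arrMark c ≠ 0).card <
                ((codes x).filter fun c =>
                  ((σ₂.update 5 (step a st).code 1).update 8 0 (σ 8 0 + 1)).update 10 0
                    (σ 10 0 + (σ 0 2 + 1)) arrMark c ≠ 0).card := by
              refine Finset.card_lt_card ((Finset.ssubset_iff_of_subset ?_).2
                ⟨(st.step a).code, ?_, ?_⟩)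
              · intro c
                simp only [Finset.mem_filter, update_of_ne, update_same, ne_eq, Nat.reduceEqDiff,
                  not_false_eq_true, g5]
                split_ifs <;> simp_all
              · simp [update_of_ne, update_same, hreach.code_step_mem ha hc]
              · simp [he]
            have := h.count
            rw [List.length_append, List.length_singleton]
            omega
          answer := by simpa [update_of_ne] using hans
          done := by
            intro j hj st' hst' a' ha'
            rw [List.getElem?_append_left (by omega)] at hst'
            exact (h.done j hj st' hst' a' ha').mono hmono hone' }
    · rw [List.getElem?_append_left hi, hst]
    · simpa [update_of_ne] using g12
    · simpa [update_of_ne] using g11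
    · exact fun _ => ⟨by simp, fun hA => by simpa [update_of_ne] using hacc hA⟩

theorem runs_processArc {σ : Memory} {Q : List (SearchState x)} {i k : ℕ} (h : SearchInv σ Q i)
    {st : SearchState x} (hst : Q[i]? = some st) (hk : k < x.arcs.length) (hvk : σ vArc 0 = k)
    (hpk : σ vArcPos 0 = 3 + k * (x.τ + 2)) :
    Runs processArc σ (180 * (x.τ + 1) ^ 2 + 170) fun σ' => ∃ Q', SearchInv σ' Q' i ∧
      Q'[i]? = some st ∧ σ' vArc 0 = k + 1 ∧ σ' vArcPos 0 = 3 + (k + 1) * (x.τ + 2) ∧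
      Done σ' Q' st x.arcs[k] ∧ ∀ st' a', Done σ Q st' a' → Done σ' Q' st' a' := by
  have hA : ArcAt x (σ 0) x.arcs[k] (σ vArcPos 0) := by
    rw [h.input, hpk]; exact arcAt_initial x hk
  have hS := h.stored i st hst
  have hmem : x.arcs[k] ∈ x.arcs := List.getElem_mem hk
  refine Runs.seq (T₁ := 180 * (x.τ + 1) ^ 2 + 150) (T₂ := 20)
    (R := fun σ' => ∃ Q', SearchInv σ' Q' i ∧
      Q'[i]? = some st ∧ σ' vArc = σ vArc ∧ σ' vArcPos = σ vArcPos ∧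
      Done σ' Q' st x.arcs[k] ∧ ∀ st' a', Done σ Q st' a' → Done σ' Q' st' a') ?_ ?_ (by omega)
  · refine Runs.ite (T₁ := 180 * (x.τ + 1) ^ 2 + 130) (fun hne => ?_) (fun he => ?_)
      (by simp [cost]; omega)
    · simp only [eval, hA.tail, h.head, hS.cur] at hne
      refine Runs.skip (by omega) ⟨Q, h, hst, rfl, rfl, fun hc => ?_, fun _ _ => id⟩
      rw [hc] at hne
      simp at hne
    · simp only [eval, hA.tail, h.head, hS.cur] at he
      have hc : x.arcs[k].1 = st.cur := Fin.ext (by omega)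
      refine Runs.seq (runs_generate h hst hA) (T₂ := 50) ?_ (by omega)
      rintro σ₁ ⟨h1, h2, h3, h4, h5⟩
      exact runs_register h hst hmem hc h1 h2 h3 h4 h5
  · rintro σ₁ ⟨Q', h', hst', e12, e11, hdone, hmono⟩
    have hτ : σ₁ 0 2 = x.τ := by rw [h'.input]; rfl
    refine Runs.set_seq (T₂ := 8) (by simp [cost]) ?_
    refine Runs.set (by simp [cost]) ⟨Q', h'.congr ?_, hst', ?_, ?_, ?_, ?_⟩
    · intro l hl
      rw [update_of_ne (by omega), update_of_ne (by omega)]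
    · simp [eval, update_same, update_of_ne, e12, hvk]
    · simp [eval, update_same, update_of_ne, e11, hpk, hτ]
      ring
    · exact hdone.mono (fun _ => id) (by simp [update_of_ne])
    · exact fun st' a' hd => (hmono st' a' hd).mono (fun _ => id) (by simp [update_of_ne])

theorem runs_processEntry {σ : Memory} {Q : List (SearchState x)} {i : ℕ} (h : SearchInv σ Q i)
    (hi : i < Q.length) (hm : 1 ≤ x.m) :
    Runs processEntry σ (400 * (x.m * (x.τ + 1) ^ 2)) fun σ' =>
      ∃ Q' : List (SearchState x), SearchInv σ' Q' (i + 1) := by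
  have hpos : 1 ≤ (x.τ + 1) ^ 2 := Nat.one_le_pow _ _ (by omega)
  have hm' : 1 ≤ x.m * (x.τ + 1) ^ 2 := Nat.mul_pos hm hpos
  have hm'' : x.m ≤ x.m * (x.τ + 1) ^ 2 := Nat.le_mul_of_pos_right _ hpos
  refine Runs.set_seq (T₂ := x.m * (180 * (x.τ + 1) ^ 2 + 176) + 26) ?_ ?_
  · simp only [cost]; nlinarith
  refine Runs.set_seq (T₂ := x.m * (180 * (x.τ + 1) ^ 2 + 176) + 23) ?_ ?_
  · simp only [cost]; omega
  simp only [eval]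
  obtain ⟨st, hst⟩ : ∃ st, Q[i]? = some st := ⟨_, List.getElem?_eq_getElem hi⟩
  refine Runs.seq (T₁ := x.m * (180 * (x.τ + 1) ^ 2 + 176) + 6) (T₂ := 17)
    (R := fun σ' => ∃ Q', SearchInv σ' Q' i ∧ Q'[i]? = some st ∧
      ∀ a ∈ x.arcs, Done σ' Q' st a) ?_ ?_ (by omega)
  · refine Runs.loop (fun σ' => ∃ Q', SearchInv σ' Q' i ∧ Q'[i]? = some st ∧
        σ' vArc 0 ≤ x.m ∧ σ' vArcPos 0 = 3 + σ' vArc 0 * (x.τ + 2) ∧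
        ∀ k (hk : k < x.arcs.length), k < σ' vArc 0 → Done σ' Q' st x.arcs[k])
      (fun σ' => x.m - σ' vArc 0) x.m (T₁ := 180 * (x.τ + 1) ^ 2 + 170) ?_ ?_ ?_ ?_ ?_
    · rintro σ₁ ⟨Q₁, h₁, hst₁, hle, hp, hd⟩ hc
      have hm0 : σ₁ 0 1 = x.m := by rw [h₁.input]; rfl
      simp [eval, hm0] at hc
      refine (runs_processArc h₁ hst₁ (k := σ₁ vArc 0)
        (show σ₁ vArc 0 < x.m by omega) rfl hp).mono le_rfl ?_
      rintro σ₂ ⟨Q₂, h₂, hst₂, hv, hp₂, hd₂, hmono⟩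
      refine ⟨⟨Q₂, h₂, hst₂, by omega, by rw [hp₂, hv], fun k hk hlt => ?_⟩, by omega⟩
      rw [hv] at hlt
      rcases Nat.lt_succ_iff_lt_or_eq.1 hlt with hlt | rfl
      exacts [hmono _ _ (hd k hk hlt), hd₂]
    · refine ⟨Q, h.congr ?_, hst, ?_, ?_, ?_⟩
      · intro l hl
        rw [update_of_ne (by omega), update_of_ne (by omega)]
      · simp [update_same]
      · simp [update_same, update_of_ne]
      · simp [update_same]
    · simp
    · simp only [cost]; rfl
    · rintro σ₁ ⟨Q₁, h₁, hst₁, hle, hp, hd⟩ hc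
      have hm0 : σ₁ 0 1 = x.m := by rw [h₁.input]; rfl
      simp [eval, hm0] at hc
      refine ⟨Q₁, h₁, hst₁, fun a ha => ?_⟩
      obtain ⟨k, hk, rfl⟩ := List.mem_iff_getElem.1 ha
      exact hd k hk (lt_of_lt_of_le hk (show x.m ≤ σ₁ vArc 0 by omega))
  · rintro σ₁ ⟨Q₁, h₁, hst₁, hd⟩
    have hτ : σ₁ 0 2 = x.τ := by rw [h₁.input]; rfl
    refine Runs.set_seq (T₂ := 7) (by simp [cost]) (Runs.set (by simp [cost]) ⟨Q₁, ?_⟩)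
    exact
      { input := by simpa [update_of_ne] using h₁.input
        head := by simp [eval, update_same, update_of_ne, h₁.head]
        headPos := by simp [eval, update_same, update_of_ne, h₁.headPos, hτ, Nat.succ_mul]
        len := by simpa [update_of_ne] using h₁.len
        lenPos := by simpa [update_of_ne] using h₁.lenPos
        stored := by
          intro j st' hj
          have hS := h₁.stored j st' hj
          refine ⟨?_, ?_, ?_, ?_⟩
          · simpa [update_of_ne] using hS.start
          · simpa [update_of_ne] using hS.cur
          · simpa [update_of_ne] using hS.base
          · simpa [update_of_ne] using hS.tok
        init_mem := h₁.init_mem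
        reachable := h₁.reachable
        marked := by simpa [update_of_ne] using h₁.marked
        count := by simpa [update_of_ne] using h₁.count
        answer := by simpa [update_of_ne] using h₁.answer
        done := by
          intro j hj st' hst' a ha
          have : Done σ₁ Q₁ st' a := by
            rcases Nat.lt_succ_iff_lt_or_eq.1 hj with hj | rfl
            · exact h₁.done j hj st' hst' a ha
            · rw [hst₁] at hst'
              exact Option.some.inj hst' ▸ hd a ha
          exact this.mono (fun _ => id) (by simp [update_of_ne]) }

/-- When all entries of the queue have been processed, the answer is correct. -/
theorem SearchInv.correct {σ : Memory} {Q : List (SearchState x)} {i : ℕ} (h : SearchInv σ Q i)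
    (hi : Q.length ≤ i) (hτ : 1 ≤ x.τ) :
    (x.HasStrongCycle → σ 1 0 = 1) ∧ (¬ x.HasStrongCycle → σ 1 0 = 0) := by
  rw [hasStrongCycle_iff_accepting hτ]
  have hdone : ∀ st ∈ Q, ∀ a ∈ x.arcs, Done σ Q st a := by
    intro st hst
    obtain ⟨j, hj, rfl⟩ := List.mem_iff_getElem.1 hst
    exact h.done j (by omega) _ (List.getElem?_eq_getElem hj)
  have hall : ∀ (L : List (Fin x.n × Fin x.n)) (s v : Fin x.n), x.D.Walk s v L →
      ofWalk s v L ∈ Q := by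
    intro L
    induction L using List.reverseRecOn with
    | nil => rintro s _ rfl; exact h.init_mem s
    | append_singleton L a ih =>
      intro s v hw
      obtain ⟨u, hu, hau, hadj, rfl⟩ := TemporalDigraph.walk_append.1 hw
      rw [← step_ofWalk s u L a]
      exact (hdone _ (ih s u hu) a ((x.mem_arcs a).2 hadj) hau).1
  constructor
  · rintro ⟨st, a, ⟨L, hw, he⟩, ha, hc, hacc⟩
    exact (hdone st (he ▸ hall L _ _ hw) a ha hc).2 hacc
  · intro hno
    exact h.answer.resolve_right fun h1 => hno h1.2

theorem runs_initTokens {σ : Memory} {τ : ℕ} (hτ : σ 0 2 = τ) :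
    Runs initTokens σ (40 * (τ + 1)) fun σ' =>
      (∀ k, k ≠ arrTok → k ≠ vJ → σ' k = σ k) ∧
      (∀ i < σ vLenPos 0, σ' arrTok i = σ arrTok i) ∧
      ∀ j ≤ τ, σ' arrTok (σ vLenPos 0 + j) = j + 1 := by
  refine Runs.set_seq (T₂ := (τ + 1) * 25 + 8) (by simp [cost]; omega) ?_
  simp only [eval]
  refine Runs.loop (fun σ' => σ' vJ 0 ≤ τ + 1 ∧ (∀ k, k ≠ arrTok → k ≠ vJ → σ' k = σ k) ∧
      (∀ i < σ vLenPos 0, σ' arrTok i = σ arrTok i) ∧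
      ∀ j < σ' vJ 0, σ' arrTok (σ vLenPos 0 + j) = j + 1)
    (fun σ' => τ + 1 - σ' vJ 0) (τ + 1) (T₁ := 17) ?_ ?_ ?_ ?_ ?_
  · rintro σ₁ ⟨hle, hfr, hlow, htok⟩ hc
    have h0 := hfr 0 (by decide) (by decide)
    have h10 := hfr 10 (by decide) (by decide)
    simp [eval, h0, hτ] at hc
    refine Runs.set_seq (T₂ := 6) (by simp [cost]) (Runs.set (by simp [cost]) ⟨⟨?_, ?_, ?_, ?_⟩, ?_⟩)
    · simp [eval, update_same, update_of_ne]; omega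
    · intro k hk hk'
      rw [update_of_ne hk', update_of_ne hk, hfr k hk hk']
    · intro i hi
      simp only [eval, update_same, update_of_ne, ne_eq, Nat.reduceEqDiff, not_false_eq_true, h10]
      rw [if_neg (by omega), hlow i hi]
    · intro j hj
      simp [eval, update_same, update_of_ne] at hj
      simp only [eval, update_same, update_of_ne, ne_eq, Nat.reduceEqDiff, not_false_eq_true, h10]
      split_ifs with he
      · omega
      · exact htok j (by omega)
    · simp [eval, update_same, update_of_ne]; omega
  · refine ⟨by simp [update_same], fun k hk hk' => by rw [update_of_ne hk'], ?_, ?_⟩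
    · simp [update_of_ne]
    · simp [update_same]
  · simp [update_same]
  · simp only [cost]; omega
  · rintro σ₁ ⟨hle, hfr, hlow, htok⟩ hc
    have h0 := hfr 0 (by decide) (by decide)
    simp [eval, h0, hτ] at hc
    exact ⟨hfr, hlow, fun j hj => htok j (by omega)⟩

/-- The memory after `k` rounds of the initialization. -/
structure InitInv (x : CycleInstance) (σ : Memory) (k : ℕ) : Prop where
  le : k ≤ x.n
  frame : ∀ l, l = 0 ∨ l = 1 ∨ l = arrMark ∨ l = vHead ∨ l = vHeadPos → σ l = initial x.encode l
  len : σ vLen 0 = k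
  lenPos : σ vLenPos 0 = k * (x.τ + 1)
  mul : σ vMul 0 = k * x.n
  stored : ∀ s : Fin x.n, s.1 < k → (ofWalk s s []).Stored σ s

theorem runs_initEntry {σ : Memory} {k : ℕ} (h : InitInv x σ k) (hk : k < x.n) :
    Runs initEntry σ (100 * (x.τ + 1)) fun σ' => InitInv x σ' (k + 1) := by
  have h0 : σ 0 = initial x.encode 0 := h.frame 0 (by simp)
  have hτ : σ 0 2 = x.τ := by rw [h0]; rfl
  have hn : σ 0 0 = x.n := by rw [h0]; rfl
  refine Runs.set_seq (T₂ := 40 * (x.τ + 1) + 45) (by simp [cost]; omega) ?_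
  refine Runs.set_seq (T₂ := 40 * (x.τ + 1) + 40) (by simp [cost]; omega) ?_
  refine Runs.set_seq (T₂ := 40 * (x.τ + 1) + 35) (by simp [cost]; omega) ?_
  refine Runs.set_seq (T₂ := 40 * (x.τ + 1) + 28) (by simp [cost]; omega) ?_
  simp only [eval, update_of_ne, ne_eq, OfNat.zero_ne_ofNat, Nat.reduceEqDiff,
    not_false_eq_true, h.len, h.mul, hn]
  refine Runs.seq (runs_initTokens (τ := x.τ) ?_) (T₂ := 28) ?_ (by omega)
  · simpa [update_of_ne] using hτ
  rintro σ₁ ⟨hfr, hlow, htok⟩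
  simp only [update_of_ne, ne_eq, Nat.reduceEqDiff, not_false_eq_true, h.lenPos] at hlow htok
  refine Runs.set_seq (T₂ := 10) (by simp [cost]) (Runs.set (by simp [cost]) ?_)
  constructor
  · exact hk
  · intro l hl
    rw [← h.frame l hl]
    rcases hl with rfl | rfl | rfl | rfl | rfl <;> simp [update_of_ne, hfr]
  · simp [eval, update_same, update_of_ne, hfr, h.len]
  · simp [eval, update_same, update_of_ne, hfr, h.lenPos, hτ, Nat.succ_mul]
  · simp [update_same, update_of_ne, hfr, Nat.succ_mul]
  · intro s hs
    rcases Nat.lt_succ_iff_lt_or_eq.1 hs with hs | rfl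
    · have hS := h.stored s hs
      refine ⟨?_, ?_, ?_, ?_⟩
      · simpa [update_same, update_of_ne, hfr, hs.ne] using hS.start
      · simpa [update_same, update_of_ne, hfr, hs.ne] using hS.cur
      · simpa [update_same, update_of_ne, hfr, hs.ne] using hS.base
      · intro j hj
        have : s.1 * (x.τ + 1) + (x.τ + 1) ≤ k * (x.τ + 1) := by
          rw [← Nat.succ_mul]; exact Nat.mul_le_mul_right _ hs
        simp only [update_of_ne, ne_eq, Nat.reduceEqDiff, not_false_eq_true]
        rw [hlow _ (by omega), hS.tok j hj]
    · refine ⟨?_, ?_, ?_, ?_⟩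
      · simp [update_same, update_of_ne, hfr, ofWalk]
      · simp [update_same, update_of_ne, hfr, ofWalk]
      · simp [update_same, update_of_ne, hfr, ofWalk]
      · intro j hj
        simp [update_of_ne, htok j hj, ofWalk, hj]

theorem InitInv.searchInv {σ : Memory} (h : InitInv x σ x.n) :
    SearchInv σ ((List.finRange x.n).map fun s => ofWalk s s []) 0 where
  input := h.frame 0 (by simp)
  head := by rw [h.frame vHead (by simp)]; rfl
  headPos := by rw [h.frame vHeadPos (by simp)]; simp [initial]
  len := by simp [h.len]
  lenPos := by simp [h.lenPos]
  stored := by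
    intro j st hj
    obtain ⟨hj', rfl⟩ := List.getElem?_eq_some_iff.1 hj
    simp only [List.length_map, List.length_finRange] at hj'
    simpa using h.stored ⟨j, hj'⟩ hj'
  init_mem := fun s => List.mem_map.2 ⟨s, List.mem_finRange s, rfl⟩
  reachable := by
    intro st hst
    obtain ⟨s, -, rfl⟩ := List.mem_map.1 hst
    exact reachable_ofWalk rfl
  marked := by
    intro c hc
    rw [h.frame arrMark (by simp)] at hc
    simp [initial] at hc
  count := by simp
  answer := Or.inl (by rw [h.frame 1 (by simp)]; rfl)
  done := by simp

/-! ### Running time -/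

theorem one_le_n_of_one_le_m (hm : 1 ≤ x.m) : 1 ≤ x.n := by
  obtain ⟨a, -⟩ := List.exists_mem_of_length_pos hm
  exact a.1.pos

/-- Correctness and running time on the instances on which the search is carried out. The queue has
at most `B` entries; each of them meets `m` arcs, with `O((τ + 1) ^ 2)` steps for each. -/
theorem runs_strongCycleProg (hm : 1 ≤ x.m) (hτ : 1 ≤ x.τ) :
    Runs strongCycleProg (initial x.encode)
      (2000 * (x.n * x.m ^ 2 * (x.τ + 1) ^ 2 * 2 ^ (x.τ + 1) ^ 2)) fun σ' =>
      (x.HasStrongCycle → σ' 1 0 = 1) ∧ (¬ x.HasStrongCycle → σ' 1 0 = 0) := by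
  have hn := one_le_n_of_one_le_m hm
  set N := 2 ^ (x.τ + 1) ^ 2 with hN
  have hN1 : 1 ≤ N := Nat.one_le_two_pow
  set S := (x.τ + 1) ^ 2 with hS
  have hS1 : x.τ + 1 ≤ S := by rw [hS]; nlinarith
  have hS2 : 1 ≤ S := by omega
  set B := x.n + x.n * x.m * N with hB
  have hBle : B ≤ 2 * (x.n * x.m * N) := by
    have : x.n * 1 ≤ x.n * (x.m * N) := Nat.mul_le_mul_left _ (Nat.mul_pos hm hN1)
    rw [hB]; nlinarith
  have hX : x.n * S ≤ x.n * x.m ^ 2 * S * N := by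
    have : 1 ≤ x.m ^ 2 * N := Nat.mul_pos (Nat.pow_pos hm) hN1
    calc x.n * S = x.n * S * 1 := by ring
      _ ≤ x.n * S * (x.m ^ 2 * N) := Nat.mul_le_mul_left _ this
      _ = _ := by ring
  have hX1 : 1 ≤ x.n * S := Nat.mul_pos hn hS2
  have hnX : x.n ≤ x.n * S := Nat.le_mul_of_pos_right _ hS2
  have hmain : B * (x.m * S) ≤ 2 * (x.n * x.m ^ 2 * S * N) := by
    calc B * (x.m * S) ≤ 2 * (x.n * x.m * N) * (x.m * S) := Nat.mul_le_mul_right _ hBle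
      _ = _ := by ring
  have hBm : B ≤ B * (x.m * S) := Nat.le_mul_of_pos_right _ (Nat.mul_pos hm hS2)
  have hnτ : x.n * (x.τ + 1) ≤ x.n * S := Nat.mul_le_mul_left _ hS1
  have hm0 : initial x.encode 0 1 = x.m := rfl
  have hτ0 : initial x.encode 0 2 = x.τ := rfl
  set X := x.n * x.m ^ 2 * S * N with hXdef
  refine Runs.ite (T₁ := 1990 * X) (fun _ => ?_) (fun he => ?_) (by simp [cost]; omega)
  swap
  · simp [eval, hm0] at he; omega
  refine Runs.ite (T₁ := 1980 * X) (fun _ => ?_) (fun he => ?_) (by simp [cost]; omega)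
  swap
  · simp [eval, hτ0] at he; omega
  refine Runs.seq (T₁ := x.n * (100 * (x.τ + 1) + 6) + 6) (T₂ := B * (400 * (x.m * S) + 6) + 6)
    (R := fun σ => InitInv x σ x.n) ?_ ?_ ?_
  · refine Runs.loop (fun σ => ∃ k, InitInv x σ k) (fun σ => x.n - σ vLen 0) x.n
      (T₁ := 100 * (x.τ + 1)) ?_ ?_ ?_ ?_ ?_
    · rintro σ ⟨k, h⟩ hc
      have hn0 : σ 0 0 = x.n := by rw [h.frame 0 (by simp)]; rfl
      simp [eval, hn0, h.len] at hc
      refine (runs_initEntry h (by omega)).mono le_rfl fun σ' h' => ⟨⟨_, h'⟩, ?_⟩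
      rw [h'.len, h.len]; omega
    · refine ⟨0, by omega, fun _ _ => rfl, rfl, ?_, ?_, by simp⟩ <;> simp [initial]
    · omega
    · simp only [cost]; rfl
    · rintro σ ⟨k, h⟩ hc
      have hn0 : σ 0 0 = x.n := by rw [h.frame 0 (by simp)]; rfl
      simp [eval, hn0, h.len] at hc
      obtain rfl : k = x.n := le_antisymm h.le (by omega)
      exact h
  · intro σ h
    refine Runs.loop (fun σ => ∃ Q i, SearchInv (x := x) σ Q i) (fun σ => B - σ vHead 0) B
      (T₁ := 400 * (x.m * S)) ?_ ⟨_, _, h.searchInv⟩ (Nat.sub_le _ _) ?_ ?_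
    · rintro σ ⟨Q, i, h⟩ hc
      simp [eval, h.head, h.len] at hc
      refine (runs_processEntry h (by omega) hm).mono le_rfl fun σ' ⟨Q', h'⟩ => ⟨⟨_, _, h'⟩, ?_⟩
      have : Q.length ≤ B := h.length_le
      rw [h'.head, h.head]; omega
    · simp only [cost]; rfl
    · rintro σ ⟨Q, i, h⟩ hc
      simp [eval, h.head, h.len] at hc
      exact h.correct (by omega) hτ
  · nlinarith

/-- The decision procedure meets the time bound on all instances. -/
theorem strongCycleProg_answers (x : CycleInstance) : ∃ t : ℕ,
    t ≤ 8000 * (x.n * x.m ^ 2 * x.τ ^ 2 * 4 ^ ((x.τ + 1) ^ 2) + 1) ∧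
      Answers strongCycleProg x.encode x.HasStrongCycle t := by
  have hm0 : initial x.encode 0 1 = x.m := rfl
  have hτ0 : initial x.encode 0 2 = x.τ := rfl
  suffices h : Runs strongCycleProg (initial x.encode)
      (8000 * (x.n * x.m ^ 2 * x.τ ^ 2 * 4 ^ ((x.τ + 1) ^ 2) + 1)) fun σ' =>
      (x.HasStrongCycle → σ' 1 0 = 1) ∧ (¬ x.HasStrongCycle → σ' 1 0 = 0) by
    obtain ⟨σ', t, hE, ht, hQ⟩ := h
    exact ⟨t, ht, σ', hE, hQ⟩
  rcases Nat.eq_zero_or_pos x.m with hm | hm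
  · refine Runs.ite (T₁ := 10) (fun hne => absurd hm hne) (fun _ => ?_)
      (by simp only [cost]; omega)
    refine Runs.skip (by omega) ⟨fun h => ?_, fun _ => rfl⟩
    obtain ⟨q, c, ⟨hq, hw, -⟩, -⟩ := h
    have := (x.mem_arcs (_, _)).2 (hw ⟨0, hq⟩)
    rw [List.length_eq_zero_iff.1 hm] at this
    simp at this
  rcases Nat.eq_zero_or_pos x.τ with hτ | hτ
  · refine Runs.ite (T₁ := 20) (fun _ => ?_) (fun he => absurd he hm.ne')
      (by simp only [cost]; omega)
    refine Runs.ite (T₁ := 10) (fun hne => absurd hτ hne) (fun _ => ?_)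
      (by simp only [cost]; omega)
    exact Runs.skip (by omega)
      ⟨fun h => absurd h (TemporalDigraph.not_hasStrongCycle_of_lifetime_eq_zero hτ), fun _ => rfl⟩
  refine (runs_strongCycleProg hm hτ).mono ?_ fun _ => id
  have h1 : (x.τ + 1) ^ 2 ≤ 4 * x.τ ^ 2 := by nlinarith
  have h2 : 2 ^ (x.τ + 1) ^ 2 ≤ 4 ^ (x.τ + 1) ^ 2 := Nat.pow_le_pow_left (by omega) _
  calc 2000 * (x.n * x.m ^ 2 * (x.τ + 1) ^ 2 * 2 ^ (x.τ + 1) ^ 2)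
      ≤ 2000 * (x.n * x.m ^ 2 * (4 * x.τ ^ 2) * 4 ^ (x.τ + 1) ^ 2) := by gcongr
    _ = 8000 * (x.n * x.m ^ 2 * x.τ ^ 2 * 4 ^ ((x.τ + 1) ^ 2)) := by ring
    _ ≤ _ := by omega

theorem computable_bound :
    Computable fun τ : ℕ => 8000 * (τ ^ 2 * 4 ^ ((τ + 1) ^ 2) + 1) := by
  have hmul : Primrec₂ fun a b : ℕ => a * b := Primrec.nat_mul
  have hpow : Primrec fun k : ℕ => 4 ^ k := by
    have : Primrec fun k : ℕ => Nat.rec (motive := fun _ => ℕ) 1 (fun _ r => 4 * r) k :=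
      Primrec.nat_rec₁ 1 (hmul.comp (Primrec.const 4) Primrec.snd).to₂
    refine this.of_eq fun k => ?_
    induction k with
    | zero => rfl
    | succ k ih => rw [pow_succ, ← ih]; exact Nat.mul_comm _ _
  have hsq : Primrec fun k : ℕ => k ^ 2 :=
    (hmul.comp Primrec.id Primrec.id).of_eq fun k => (sq k).symm
  exact (hmul.comp (Primrec.const 8000) (Primrec.succ.comp
    (hmul.comp hsq (hpow.comp (hsq.comp Primrec.succ))))).to_comp

end RAM

/-- Strong Cycle Detection is fixed-parameter tractable with respect to the lifetime `τ`, and it is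
decided by an algorithm running in time `O(n m² τ² 4^((τ+1)²))` (the summand `1` only matters when
`m = 0` or `τ = 0`). -/
theorem mainTheorem2 :
    RAM.FixedParameterTractable CycleInstance.encode (fun x => x.n + x.m) CycleInstance.τ
        CycleInstance.HasStrongCycle ∧
      ∃ (c : RAM.Prog) (K : ℕ), ∀ x : CycleInstance, ∃ t : ℕ,
        t ≤ K * (x.n * x.m ^ 2 * x.τ ^ 2 * 4 ^ ((x.τ + 1) ^ 2) + 1) ∧
          RAM.Answers c x.encode x.HasStrongCycle t := by
  refine ⟨⟨RAM.strongCycleProg, _, 3, RAM.computable_bound, fun x => ?_⟩,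
    RAM.strongCycleProg, 8000, RAM.strongCycleProg_answers⟩
  obtain ⟨t, ht, hA⟩ := RAM.strongCycleProg_answers x
  refine ⟨t, ht.trans ?_, hA⟩
  have h1 : x.n * x.m ^ 2 ≤ (x.n + x.m + 1) ^ 3 :=
    calc x.n * x.m ^ 2 ≤ (x.n + x.m + 1) * (x.n + x.m + 1) ^ 2 := by gcongr <;> omega
      _ = _ := by ring
  have h2 : 1 ≤ (x.n + x.m + 1) ^ 3 := Nat.one_le_pow _ _ (by omega)
  calc 8000 * (x.n * x.m ^ 2 * x.τ ^ 2 * 4 ^ ((x.τ + 1) ^ 2) + 1)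
      = 8000 * (x.n * x.m ^ 2 * (x.τ ^ 2 * 4 ^ ((x.τ + 1) ^ 2)) + 1) := by ring
    _ ≤ 8000 * ((x.n + x.m + 1) ^ 3 * (x.τ ^ 2 * 4 ^ ((x.τ + 1) ^ 2)) +
          (x.n + x.m + 1) ^ 3) := by gcongr
    _ = _ := by ring
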